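/- Let $\Gamma=\Gamma_A\cup\Gamma_B$ be the hexagonal lattice, $\Gamma_A=\{ja_1+ka_2: j,k\in\mathbb Z\}$ with $a_1=(\sqrt3,0)$, $a_2=\tfrac12(\sqrt3,3)$, and $\Gamma_B=\Gamma_A+(0,1)$; write $A_{j,k}=ja_1+ka_2$ and $B_{j,k}=A_{j,k}+(0,1)$. Let $|x-y|$ be the length of a shortest path connecting $x$ and $y$ in the nearest-neighbour graph of $\Gamma$. Define bijections $S_1,S_2,S_3$ of $\Gamma$ by $$S_1A_{j,k}=B_{j,k-1},\quad S_1B_{j,k}=A_{j-1,k+1},\quad S_2A_{j,k}=B_{j+1,k-1},\quad S_2B_{j,k}=A_{j,k},\quad S_3A_{j,k}=B_{j,k},\quad S_3B_{j,k}=A_{j,k+1}.$$ On $\mathcal H=\ell^2(\Gamma)\otimes\mathbb C^3$, with orthonormal basis $x^{(i)}=|x\rangle\otimes e_i$ ($x\in\Gamma$, $i\in\{1,2,3\}$), let $S$ be the unitary operator with $S x^{(i)}=(S_i x)^{(i)}$, and for $C\in U(3)$ let $\mathcal C(C)(|x\rangle\otimes\tau)=|x\rangle\otimes C\tau$. Let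 $(\omega_{x,j})_{x\in\Gamma,\,j\in\{1,2,3\}}$ be independent random variables on a probability space, each uniformly distributed on $[0,2\pi)$, let $D_\omega x^{(j)}=e^{i\omega_{x,j}}x^{(j)}$, and let $U_\omega(C)=D_\omega S\,\mathcal C(C)$ be the random quantum walk. Finally let $$C_0=\begin{pmatrix}0&1&0\\0&0&1\\1&0&0\end{pmatrix},\qquad \|M\|_\infty=\max_{a,b}|M_{ab}|.$$ Then there exist constants $\varphi,c,g>0$ such that for every $C\in U(3)$ with $\|C-C_0\|_\infty\le\varphi$, all sites $x,y\in\Gamma$ and all coin states $i,j\in\{1,2,3\}$, $$\mathbb E\Big(\sup_{n\in\mathbb Z}\big|\langle x^{(i)}\,|\,U_\omega(C)^n\,y^{(j)}\rangle\big|\Big)\le c\,e^{-g|x-y|}.$$ -/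

import Mathlib

open MeasureTheory ProbabilityTheory
open scoped ENNReal

noncomputable section

namespace HexWalk

/-! ### The hexagonal lattice -/

/-- Sites of the hexagonal lattice `Γ = Γ_A ∪ Γ_B`. With `a₁ = (√3, 0)` and `a₂ = (√3/2, 3/2)`,
`A j k` is the site `j a₁ + k a₂` of `Γ_A`, and `B j k` is the site `j a₁ + k a₂ + (0, 1)` of
`Γ_B`. -/
inductive Site : Type
  | A (j k : ℤ)
  | B (j k : ℤ)
  deriving DecidableEq

/-- The three shifts; the coin states `1, 2, 3` are `0, 1, 2 : Fin 3`. Every shift moves a site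
to one of its three nearest neighbours. -/
def shift : Fin 3 → Site → Site
  | 0, .A j k => .B j (k - 1)
  | 0, .B j k => .A (j - 1) (k + 1)
  | 1, .A j k => .B (j + 1) (k - 1)
  | 1, .B j k => .A j k
  | 2, .A j k => .B j k
  | 2, .B j k => .A j (k + 1)

/-- The inverses of the three shifts. -/
def shiftInv : Fin 3 → Site → Site
  | 0, .A j k => .B (j + 1) (k - 1)
  | 0, .B j k => .A j (k + 1)
  | 1, .A j k => .B j k
  | 1, .B j k => .A (j - 1) (k + 1)
  | 2, .A j k => .B j (k - 1)
  | 2, .B j k => .A j k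

theorem shiftInv_shift (i : Fin 3) (x : Site) : shiftInv i (shift i x) = x := by
  fin_cases i <;> cases x <;> simp [shift, shiftInv]

theorem shift_shiftInv (i : Fin 3) (x : Site) : shift i (shiftInv i x) = x := by
  fin_cases i <;> cases x <;> simp [shift, shiftInv]

/-- The nearest-neighbour graph of the hexagonal lattice. -/
def latticeGraph : SimpleGraph Site where
  Adj x y := ∃ i : Fin 3, shift i x = y
  symm := ⟨by
    rintro x y ⟨i, rfl⟩
    fin_cases i <;> cases x
    · exact ⟨2, by simp [shift]⟩
    · exact ⟨1, by simp [shift]⟩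
    · exact ⟨0, by simp [shift]⟩
    · exact ⟨2, by simp [shift]⟩
    · exact ⟨1, by simp [shift]⟩
    · exact ⟨0, by simp [shift]⟩⟩
  loopless := ⟨by
    rintro x ⟨i, h⟩
    fin_cases i <;> cases x <;> simp [shift] at h⟩

theorem reachable_shift (x : Site) (i) : latticeGraph.Reachable x (shift i x) :=
  SimpleGraph.Adj.reachable ⟨i, rfl⟩

theorem reachable_A : ∀ j k j' k' : ℤ, latticeGraph.Reachable (.A j k) (.A j' k') := by
  have h1 : ∀ j k, latticeGraph.Reachable (.A j k) (.A j (k+1)) := fun j k => by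
    have := (reachable_shift (.A j k) 2).trans (reachable_shift (.B j k) 2)
    simpa [shift] using this
  have h2 : ∀ j k, latticeGraph.Reachable (.A j k) (.A (j+1) k) := fun j k => by
    have := (reachable_shift (.A j k) 1).trans (reachable_shift (.B (j+1) (k-1)) 2)
    simpa [shift] using this
  have h3 : ∀ j k, latticeGraph.Reachable (.A j 0) (.A j k) := fun j k => by
    induction k using Int.induction_on with
    | zero => rfl
    | succ n ih => exact ih.trans (h1 _ _)
    | pred n ih => exact ih.trans (by simpa using (h1 j (-n-1)).symm)
  have h4 : ∀ j, latticeGraph.Reachable (.A 0 0) (.A j 0) := fun j => by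
    induction j using Int.induction_on with
    | zero => rfl
    | succ n ih => exact ih.trans (h2 _ _)
    | pred n ih => exact ih.trans (by simpa using (h2 (-n-1) 0).symm)
  intro j k j' k'
  exact ((h4 j).trans (h3 j k)).symm.trans ((h4 j').trans (h3 j' k'))

/-- The lattice is connected, so the distance below is a genuine one. -/
theorem latticeGraph_connected : latticeGraph.Connected where
  preconnected := by
    have h : ∀ x, latticeGraph.Reachable x (.A 0 0) := by
      rintro (⟨j,k⟩|⟨j,k⟩)
      · exact reachable_A _ _ _ _
      · exact (reachable_shift (.B j k) 1).trans (reachable_A _ _ _ _)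
    exact fun x y => (h x).trans (h y).symm
  nonempty := ⟨.A 0 0⟩

/-- The lattice distance `|x - y|`: the length of a shortest path connecting `x` and `y`. -/
def latticeDist (x y : Site) : ℕ := latticeGraph.dist x y

/-! ### The Hilbert space and its unitary operators -/

/-- The Hilbert space `ℓ²(Γ) ⊗ ℂ³ ≃ ℓ²(Γ × {1, 2, 3})`. -/
abbrev H : Type := lp (fun _ : Site × Fin 3 => ℂ) 2

/-- The basis vector `x^(i) = |x⟩ ⊗ e_i`. -/
def ket (x : Site) (i : Fin 3) : H := lp.single 2 (x, i) (1 : ℂ)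

theorem memlp_iff_tsum (f : Site × Fin 3 → ℂ) :
    Memℓp f 2 ↔ ∑' a, ENNReal.ofReal (‖f a‖ ^ 2) ≠ ∞ := by
  rw [memℓp_gen_iff (by norm_num)]
  simp only [ENNReal.toReal_ofNat, Real.rpow_ofNat]
  constructor
  · intro h
    exact h.tsum_ofReal_ne_top
  · intro h
    have := ENNReal.summable_toReal h
    simpa [ENNReal.toReal_ofReal] using this

theorem norm_sq_eq_tsum (f : H) :
    ENNReal.ofReal (‖f‖ ^ 2) = ∑' a, ENNReal.ofReal (‖f a‖ ^ 2) := by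
  have h := lp.norm_rpow_eq_tsum (p := 2) (by norm_num) f
  have hs := (memℓp_gen_iff (p := 2) (by norm_num)).1 (lp.memℓp f)
  simp only [ENNReal.toReal_ofNat, Real.rpow_ofNat] at h hs
  rw [h, ENNReal.ofReal_tsum_of_nonneg (fun _ => by positivity) hs]

/-- A linear bijection of the space of all functions that preserves the sum of the squared absolute
values restricts to a unitary operator on `H`. -/
def toUnitary (T : (Site × Fin 3 → ℂ) ≃ₗ[ℂ] (Site × Fin 3 → ℂ))
    (hT : ∀ f, ∑' a, ENNReal.ofReal (‖T f a‖ ^ 2) = ∑' a, ENNReal.ofReal (‖f a‖ ^ 2)) :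
    H ≃ₗᵢ[ℂ] H where
  toFun f := ⟨T f, (memlp_iff_tsum _).2 (by
    rw [hT]; exact (memlp_iff_tsum _).1 (lp.memℓp f))⟩
  invFun f := ⟨T.symm f, (memlp_iff_tsum _).2 (by
    rw [← hT, T.apply_symm_apply]; exact (memlp_iff_tsum _).1 (lp.memℓp f))⟩
  map_add' f g := by ext a; exact congrFun (T.map_add f g) a
  map_smul' r f := by ext a; simp
  left_inv f := by ext a; simp
  right_inv f := by ext a; simp
  norm_map' f := by
    have h : ENNReal.ofReal (‖(⟨T f, (memlp_iff_tsum _).2 (by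
        rw [hT]; exact (memlp_iff_tsum _).1 (lp.memℓp f))⟩ : H)‖ ^ 2)
        = ENNReal.ofReal (‖f‖ ^ 2) := by
      rw [norm_sq_eq_tsum, norm_sq_eq_tsum]
      exact hT f
    rw [ENNReal.ofReal_eq_ofReal_iff (by positivity) (by positivity)] at h
    exact (pow_left_inj₀ (norm_nonneg _) (norm_nonneg _) two_ne_zero).1 h

/-- The action of the shifts on the labels of the basis: `(x, i) ↦ (S_i x, i)`. -/
def shiftEquiv : Site × Fin 3 ≃ Site × Fin 3 where
  toFun a := (shift a.2 a.1, a.2)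
  invFun a := (shiftInv a.2 a.1, a.2)
  left_inv a := by simp [shiftInv_shift]
  right_inv a := by simp [shift_shiftInv]

/-- The shift operator `S`, with `S x^(i) = (S_i x)^(i)`; hence the value of `S f` at `a` is the
value of `f` at the preimage of `a`. -/
def shiftOp : H ≃ₗᵢ[ℂ] H :=
  toUnitary (LinearEquiv.funCongrLeft ℂ ℂ shiftEquiv.symm) fun f =>
    shiftEquiv.symm.tsum_eq fun a => ENNReal.ofReal (‖f a‖ ^ 2)

/-- The multiplication by the phases `e^{i θ(x, j)}` on functions. -/
def phaseEquiv (θ : Site × Fin 3 → ℝ) : (Site × Fin 3 → ℂ) ≃ₗ[ℂ] (Site × Fin 3 → ℂ) where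
  toFun f a := Complex.exp (Complex.I * θ a) * f a
  invFun f a := Complex.exp (-(Complex.I * θ a)) * f a
  map_add' f g := by ext a; simp [mul_add]
  map_smul' r f := by ext a; simp [mul_left_comm]
  left_inv f := by ext a; simp [← mul_assoc, ← Complex.exp_add]
  right_inv f := by ext a; simp [← mul_assoc, ← Complex.exp_add]

/-- The operator `D`, with `D x^(j) = e^{i θ(x, j)} x^(j)`. -/
def phaseOp (θ : Site × Fin 3 → ℝ) : H ≃ₗᵢ[ℂ] H :=
  toUnitary (phaseEquiv θ) fun f => by
    simp [phaseEquiv, Complex.norm_exp]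

/-- A unitary matrix acting on the coin component of functions. -/
def coinEquiv (C : Matrix.unitaryGroup (Fin 3) ℂ) :
    (Site × Fin 3 → ℂ) ≃ₗ[ℂ] (Site × Fin 3 → ℂ) where
  toFun f a := ∑ j, (C : Matrix (Fin 3) (Fin 3) ℂ) a.2 j * f (a.1, j)
  invFun f a := ∑ j, (star C : Matrix (Fin 3) (Fin 3) ℂ) a.2 j * f (a.1, j)
  map_add' f g := by ext a; simp [mul_add, Finset.sum_add_distrib]
  map_smul' r f := by ext a; simp [Finset.mul_sum, mul_left_comm]
  left_inv f := by
    ext ⟨x, i⟩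
    have h : (star C : Matrix (Fin 3) (Fin 3) ℂ) * (C : Matrix (Fin 3) (Fin 3) ℂ) = 1 :=
      Matrix.UnitaryGroup.star_mul_self C
    have := congrFun (congrArg (fun M => Matrix.mulVec M (fun j => f (x, j))) h) i
    simp only [← Matrix.mulVec_mulVec, Matrix.one_mulVec] at this
    exact this
  right_inv f := by
    ext ⟨x, i⟩
    have h : (C : Matrix (Fin 3) (Fin 3) ℂ) * (star C : Matrix (Fin 3) (Fin 3) ℂ) = 1 :=
      Unitary.coe_mul_star_self C
    have := congrFun (congrArg (fun M => Matrix.mulVec M (fun j => f (x, j))) h) i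
    simp only [← Matrix.mulVec_mulVec, Matrix.one_mulVec] at this
    exact this

/-- The coin operator `𝒞(C)`, with `𝒞(C) (|x⟩ ⊗ τ) = |x⟩ ⊗ C τ`. -/
def coinOp (C : Matrix.unitaryGroup (Fin 3) ℂ) : H ≃ₗᵢ[ℂ] H :=
  toUnitary (coinEquiv C) fun f => by
    rw [ENNReal.tsum_prod', ENNReal.tsum_prod']
    refine tsum_congr fun x => ?_
    rw [tsum_fintype, tsum_fintype,
      ← ENNReal.ofReal_sum_of_nonneg (fun _ _ => by positivity),
      ← ENNReal.ofReal_sum_of_nonneg (fun _ _ => by positivity)]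
    congr 1
    let v : Fin 3 → ℂ := fun j => f (x, j)
    have key : ∀ w : Fin 3 → ℂ, ((∑ i, ‖w i‖ ^ 2 : ℝ) : ℂ) = star w ⬝ᵥ w := fun w => by
      simp [dotProduct, Complex.conj_mul']
    have h : (star C : Matrix (Fin 3) (Fin 3) ℂ) * (C : Matrix (Fin 3) (Fin 3) ℂ) = 1 :=
      Matrix.UnitaryGroup.star_mul_self C
    have h2 : star (Matrix.mulVec (C : Matrix (Fin 3) (Fin 3) ℂ) v) ⬝ᵥ
        Matrix.mulVec (C : Matrix (Fin 3) (Fin 3) ℂ) v = star v ⬝ᵥ v := by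
      rw [Matrix.star_mulVec, ← Matrix.dotProduct_mulVec, Matrix.mulVec_mulVec]
      rw [Matrix.star_eq_conjTranspose] at h
      rw [h, Matrix.one_mulVec]
    rw [← key, ← key] at h2
    exact_mod_cast h2

/-- The quantum walk `U(C) = D S 𝒞(C)` with phases `θ`, in the group of unitary operators on `H`
(multiplication is composition). -/
def walk (θ : Site × Fin 3 → ℝ) (C : Matrix.unitaryGroup (Fin 3) ℂ) : H ≃ₗᵢ[ℂ] H :=
  phaseOp θ * shiftOp * coinOp C

/-- The permutation matrix `C₀` inducing full localization. -/
def C₀ : Matrix (Fin 3) (Fin 3) ℂ := !![0, 1, 0; 0, 0, 1; 1, 0, 0]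

/-- The entrywise maximum norm `‖M‖_∞` of a `3 × 3` matrix. -/
def maxNorm (M : Matrix (Fin 3) (Fin 3) ℂ) : ℝ :=
  Finset.univ.sup' Finset.univ_nonempty fun ab : Fin 3 × Fin 3 => ‖M ab.1 ab.2‖

end HexWalk

end

/-! The proof is a fractional-moment argument for the resolvent `G(z) = (1 - z U)⁻¹`, `‖z‖ < 1`,
with bounds uniform in `z`.

For `C = C₀` the walk only permutes basis vectors, up to phases, along cycles of length 6. For `C`
near `C₀`, following the resolvent equation once around the cycle through `c` gives `(1 - e^{iω_c}
ζ) G(c, b)` in terms of twelve resolvent entries at neighbouring labels, each with a coefficient of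
size at most `φ` (`norm_one_sub_cycle_mul_green_le`); here `ζ` does not involve `ω_c`.

A single phase enters `U` as a factor of one row, so by rank-one perturbation `‖G(a, b)‖ = ‖h‖ / ‖1
- e^{iω_a} f‖` with `h`, `f` independent of `ω_a` and `‖f‖ ≤ ‖z‖` (`norm_green_scaleRow`). The power
`1/2` makes this integrable in `ω_a` uniformly in `f`. Hence the moments `E ‖G‖^{1/2}` are bounded a
priori (`fracMoment_le`), and the factor `1 - e^{iω_c} ζ` can be removed at the cost of a constant
(`fracMoment_le_decoupled`). For small `φ` the cycle estimate is then a contraction, and iterating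
it gives exponential decay (`fracMoment_le_pow`, `fracMoment_le_exp`).

To reach the dynamics, unitarity turns fractional moments into weighted second moments: `(1 - ‖z‖²)
E ‖G(a, b)‖² ≤ 2 E ‖G(a, b)‖^{1/2}` (`lintegral_green_sq_le`). For `n ≥ 0`, the number `r^n ⟨a, U^n
b⟩` is a Fourier coefficient in `t` of `(1 - r²)` times the inner product of two resolvent rows at
`z = r e^{it}` (`pow_mul_walkOp_pow_apply_eq`). The integral of the absolute values, `correlator`,
therefore dominates all times at once (negative ones by unitarity), and its expectation decays by
Cauchy-Schwarz, uniformly in `r < 1`. Fatou's lemma as `r → 1` removes the weight `r^|n|`. -/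

namespace HexWalk

noncomputable section

/-! ### Resolvents of contractions and rank-one dependence on one row -/

section Resolvent

/-- The Hilbert space of square summable functions on `ι`. -/
abbrev L2 (ι : Type*) : Type _ := lp (fun _ : ι => ℂ) 2

theorem L2.add_apply {ι : Type*} (x y : L2 ι) (a : ι) : (x + y) a = x a + y a := rfl

theorem L2.smul_apply {ι : Type*} (c : ℂ) (x : L2 ι) (a : ι) : (c • x) a = c * x a := rfl

/-- The resolvent `(1 - z T)⁻¹`, as a power series. -/
def resolvent {ι : Type*} (T : L2 ι →L[ℂ] L2 ι) (z : ℂ) : L2 ι →L[ℂ] L2 ι := ∑' n : ℕ, (z • T) ^ n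

theorem norm_smul_lt_one {ι : Type*} {T : L2 ι →L[ℂ] L2 ι} (hT : ‖T‖ ≤ 1) {z : ℂ}
    (hz : ‖z‖ < 1) : ‖z • T‖ < 1 := by
  rw [norm_smul]
  exact (mul_le_of_le_one_right (norm_nonneg _) hT).trans_lt hz

theorem resolvent_apply_eq {ι : Type*} {T : L2 ι →L[ℂ] L2 ι} (hT : ‖T‖ ≤ 1) {z : ℂ} (hz : ‖z‖ < 1)
    (v : L2 ι) : resolvent T z v = v + z • T (resolvent T z v) := by
  have h := mul_neg_geom_series (z • T) (norm_smul_lt_one hT hz)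
  have h2 := congrArg (fun S : L2 ι →L[ℂ] L2 ι => S v) h
  simp only [mul_apply_eq_comp, sub_apply, one_apply_eq_self, smul_apply] at h2
  exact sub_eq_iff_eq_add.1 h2

theorem eq_resolvent {ι : Type*} {T : L2 ι →L[ℂ] L2 ι} (hT : ‖T‖ ≤ 1) {z : ℂ} (hz : ‖z‖ < 1)
    {x v : L2 ι} (hx : x = v + z • T x) : x = resolvent T z v := by
  have h := geom_series_mul_neg (z • T) (norm_smul_lt_one hT hz)
  have h2 := congrArg (fun S : L2 ι →L[ℂ] L2 ι => S x) h
  simp only [mul_apply_eq_comp, sub_apply, one_apply_eq_self, smul_apply] at h2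
  rw [sub_eq_iff_eq_add.2 hx] at h2
  exact h2.symm

variable {ι : Type*} [DecidableEq ι]

/-- The standard basis vector of `L2 ι` at `a`. -/
def basisVec (a : ι) : L2 ι := lp.single 2 a 1

theorem basisVec_apply (a c : ι) : (basisVec a : L2 ι) c = if c = a then 1 else 0 := by
  rw [basisVec, lp.single_apply, Pi.single_apply]

@[simp] theorem basisVec_self (a : ι) : (basisVec a : L2 ι) a = 1 := by simp [basisVec_apply]

theorem basisVec_ne {a c : ι} (h : c ≠ a) : (basisVec a : L2 ι) c = 0 := by
  simp [basisVec_apply, h]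

theorem inner_basisVec_left (a : ι) (x : L2 ι) : inner ℂ (basisVec a) x = x a := by
  rw [basisVec, lp.inner_single_left]; simp

theorem norm_basisVec (a : ι) : ‖(basisVec a : L2 ι)‖ = 1 := by
  have h := inner_self_eq_norm_sq (𝕜 := ℂ) (basisVec a : L2 ι)
  rw [inner_basisVec_left, basisVec_self] at h
  exact (pow_eq_one_iff_of_nonneg (norm_nonneg _) two_ne_zero).1 (by simpa using h.symm)

theorem norm_apply_le (x : L2 ι) (a : ι) : ‖x a‖ ≤ ‖x‖ := by
  rw [← inner_basisVec_left]
  simpa [norm_basisVec] using norm_inner_le_norm (𝕜 := ℂ) (basisVec a) x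

theorem norm_add_smul_basisVec_sq (x : L2 ι) (a : ι) (c : ℂ) :
    ‖x + c • basisVec a‖ ^ 2 = ‖x‖ ^ 2 - ‖x a‖ ^ 2 + ‖x a + c‖ ^ 2 := by
  have h1 := norm_add_sq (𝕜 := ℂ) x (c • basisVec a)
  have h2 := norm_add_sq (𝕜 := ℂ) (x a) c
  have h3 : inner ℂ x (c • basisVec a) = inner ℂ (x a) c := by
    rw [inner_smul_right, ← inner_conj_symm, inner_basisVec_left]
    simp
  rw [h1, h2, h3, norm_smul, norm_basisVec]
  ring

/-- Multiplication of the row `a` of an operator by the number `u`. -/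
def scaleRow (a : ι) (u : ℂ) (T : L2 ι →L[ℂ] L2 ι) : L2 ι →L[ℂ] L2 ι :=
  T + (u - 1) • ((innerSL ℂ (basisVec a)).smulRight (basisVec a)).comp T

theorem scaleRow_apply (a : ι) (u : ℂ) (T : L2 ι →L[ℂ] L2 ι) (x : L2 ι) :
    scaleRow a u T x = T x + ((u - 1) * T x a) • basisVec a := by
  simp [scaleRow, inner_basisVec_left, smul_smul]

theorem scaleRow_apply_self (a : ι) (u : ℂ) (T : L2 ι →L[ℂ] L2 ι) (x : L2 ι) :
    scaleRow a u T x a = u * T x a := by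
  rw [scaleRow_apply, L2.add_apply, L2.smul_apply, basisVec_self]; ring

theorem scaleRow_apply_ne {a c : ι} (h : c ≠ a) (u : ℂ) (T : L2 ι →L[ℂ] L2 ι) (x : L2 ι) :
    scaleRow a u T x c = T x c := by
  rw [scaleRow_apply, L2.add_apply, L2.smul_apply, basisVec_ne h]; ring

theorem scaleRow_comm {a b : ι} (hab : a ≠ b) (u v : ℂ) (T : L2 ι →L[ℂ] L2 ι) :
    scaleRow a u (scaleRow b v T) = scaleRow b v (scaleRow a u T) := by
  ext x c
  by_cases h : c = a
  · subst h; simp [scaleRow_apply_self, scaleRow_apply_ne hab]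
  · by_cases h' : c = b
    · subst h'; simp [scaleRow_apply_self, scaleRow_apply_ne h]
    · simp [scaleRow_apply_ne h, scaleRow_apply_ne h']

theorem norm_scaleRow_le (a : ι) {u : ℂ} (hu : ‖u‖ ≤ 1) {T : L2 ι →L[ℂ] L2 ι} (hT : ‖T‖ ≤ 1) :
    ‖scaleRow a u T‖ ≤ 1 := by
  refine ContinuousLinearMap.opNorm_le_bound _ zero_le_one fun x => ?_
  have h1 : ‖T x‖ ≤ ‖x‖ := by simpa using T.le_of_opNorm_le hT x
  rw [one_mul]
  refine le_trans ?_ h1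
  have h := norm_add_smul_basisVec_sq (T x) a ((u - 1) * T x a)
  rw [← scaleRow_apply, show T x a + (u - 1) * T x a = u * T x a by ring, norm_mul, mul_pow] at h
  refine le_of_sq_le_sq ?_ (norm_nonneg _)
  rw [h]
  have : ‖u‖ ^ 2 ≤ 1 := pow_le_one₀ (norm_nonneg _) hu
  nlinarith [sq_nonneg ‖T x a‖]

/-- The matrix elements of the resolvent. -/
def green (T : L2 ι →L[ℂ] L2 ι) (z : ℂ) (a b : ι) : ℂ := resolvent T z (basisVec b) a

theorem green_eq {T : L2 ι →L[ℂ] L2 ι} (hT : ‖T‖ ≤ 1) {z : ℂ} (hz : ‖z‖ < 1) (a b : ι) :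
    green T z a b = (if a = b then 1 else 0) + z * T (resolvent T z (basisVec b)) a := by
  have h := congrArg (fun x : L2 ι => x a) (resolvent_apply_eq hT hz (basisVec b))
  simp only [L2.add_apply, L2.smul_apply, basisVec_apply] at h
  exact h

/-- Elimination of the row `a`. -/
theorem resolvent_scaleRow {T : L2 ι →L[ℂ] L2 ι} (hT : ‖T‖ ≤ 1) {z : ℂ} (hz : ‖z‖ < 1)
    (a b : ι) {u : ℂ} (hu : ‖u‖ ≤ 1) :
    ∃ s : ℂ, resolvent (scaleRow a u T) z (basisVec b) =
        resolvent (scaleRow a 0 T) z (basisVec b) +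
          (u * s) • resolvent (scaleRow a 0 T) z (basisVec a) ∧
      s * (1 - u * (z * T (resolvent (scaleRow a 0 T) z (basisVec a)) a)) =
        z * T (resolvent (scaleRow a 0 T) z (basisVec b)) a := by
  have hTu := norm_scaleRow_le a hu hT
  have hT0 := norm_scaleRow_le a (u := 0) (by simp) hT
  set x := resolvent (scaleRow a u T) z (basisVec b) with hx
  -- The contribution of row `a` is moved into the inhomogeneity, leaving an equation for the
  -- operator with that row deleted.
  have h1 : x = resolvent (scaleRow a 0 T) z (basisVec b + (u * (z * T x a)) • basisVec a) := by
    refine eq_resolvent hT0 hz ?_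
    have h := resolvent_apply_eq hTu hz (basisVec b)
    rw [← hx, scaleRow_apply] at h
    conv_lhs => rw [h]
    rw [scaleRow_apply, smul_add, smul_add, smul_smul, smul_smul]
    module
  rw [map_add, map_smul] at h1
  refine ⟨z * T x a, h1, ?_⟩
  have h2 : T x a = T (resolvent (scaleRow a 0 T) z (basisVec b)) a +
      (u * (z * T x a)) * T (resolvent (scaleRow a 0 T) z (basisVec a)) a := by
    conv_lhs => rw [h1, map_add, map_smul, L2.add_apply, L2.smul_apply]
  linear_combination z * h2

theorem green_scaleRow_zero {T : L2 ι →L[ℂ] L2 ι} (hT : ‖T‖ ≤ 1) {z : ℂ} (hz : ‖z‖ < 1)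
    (a b : ι) : green (scaleRow a 0 T) z a b = if a = b then 1 else 0 := by
  rw [green_eq (norm_scaleRow_le a (by simp) hT) hz, scaleRow_apply_self]
  simp

/-- With `x` the solution and `y = z T x`, deleting entry `a` of `y` and adding `e_b` is orthogonal
because `x_b = 1`, so `‖x‖² = ‖y‖² - ‖y_a‖² + 1`. Combined with `‖y‖ ≤ ‖z‖ ‖x‖` and `‖x‖ ≥ 1`, this
bounds `y_a`. The hypothesis `hb` holds for `b = a`, and also when row `b` of `T` is zero. -/
theorem norm_row_sq_le {T : L2 ι →L[ℂ] L2 ι} (hT : ‖T‖ ≤ 1) {z : ℂ} (hz : ‖z‖ < 1) (a b : ι)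
    (hb : green (scaleRow a 0 T) z b b = 1) :
    ‖z * T (resolvent (scaleRow a 0 T) z (basisVec b)) a‖ ≤ ‖z‖ := by
  have hT0 := norm_scaleRow_le a (u := 0) (by simp) hT
  set x := resolvent (scaleRow a 0 T) z (basisVec b) with hx
  set y := z • T x with hy
  have hxeq : x = (y + (-(y a)) • basisVec a) + (1 : ℂ) • basisVec b := by
    have h := resolvent_apply_eq hT0 hz (basisVec b)
    rw [← hx, scaleRow_apply] at h
    conv_lhs => rw [h]
    simp only [hy, L2.smul_apply]
    module
  have hxb : x b = 1 := hb
  have h1 := norm_add_smul_basisVec_sq (y + (-(y a)) • basisVec a) b 1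
  have h0 : (y + (-(y a)) • basisVec a : L2 ι) b = 0 := by
    have := congrArg (fun x : L2 ι => x b) hxeq
    simp only [L2.add_apply, L2.smul_apply, basisVec_self,
      hxb] at this ⊢
    simpa using this
  have h2 := norm_add_smul_basisVec_sq y a (-(y a))
  rw [← hxeq, h0, h2] at h1
  have h3 : ‖y‖ ≤ ‖z‖ * ‖x‖ := by
    rw [hy, norm_smul]
    exact mul_le_mul_of_nonneg_left (by simpa using T.le_of_opNorm_le hT x) (norm_nonneg _)
  have h4 : 1 ≤ ‖x‖ := by
    have := norm_apply_le x b
    simpa [hxb] using this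
  have h5 : ‖y a‖ ≤ ‖z‖ := by
    refine le_of_sq_le_sq ?_ (norm_nonneg _)
    have h6 : ‖y‖ ^ 2 ≤ ‖z‖ ^ 2 * ‖x‖ ^ 2 := by rw [← mul_pow]; gcongr
    simp at h1
    have h7 : ‖z‖ ^ 2 ≤ 1 := pow_le_one₀ (norm_nonneg _) hz.le
    nlinarith [mul_nonneg (sub_nonneg.2 h7) (sub_nonneg.2 (one_le_pow₀ h4 : 1 ≤ ‖x‖ ^ 2))]
  simpa only [hy, L2.smul_apply] using h5

/-- The coefficient through which the resolvent depends on a factor of the row `a`. -/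
def rowCoeff (T : L2 ι →L[ℂ] L2 ι) (z : ℂ) (a : ι) : ℂ :=
  z * T (resolvent (scaleRow a 0 T) z (basisVec a)) a

theorem norm_rowCoeff_le {T : L2 ι →L[ℂ] L2 ι} (hT : ‖T‖ ≤ 1) {z : ℂ} (hz : ‖z‖ < 1) (a : ι) :
    ‖rowCoeff T z a‖ ≤ ‖z‖ :=
  norm_row_sq_le hT hz a a (by simp [green_scaleRow_zero hT hz])

theorem one_sub_mul_rowCoeff_ne_zero {T : L2 ι →L[ℂ] L2 ι} (hT : ‖T‖ ≤ 1) {z : ℂ} (hz : ‖z‖ < 1)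
    (a : ι) {u : ℂ} (hu : ‖u‖ ≤ 1) : 1 - u * rowCoeff T z a ≠ 0 := by
  intro h
  have h1 : ‖u * rowCoeff T z a‖ = 1 := by rw [← sub_eq_zero.1 h]; simp
  rw [norm_mul] at h1
  have := norm_rowCoeff_le hT hz a
  nlinarith [norm_nonneg u, norm_nonneg (rowCoeff T z a)]

/-- All dependence on `u` is explicit: numerator coefficient and `rowCoeff` come from the operator
without row `a`. The next two lemmas treat the column and the diagonal entry in the same way. -/
theorem green_scaleRow_row {T : L2 ι →L[ℂ] L2 ι} (hT : ‖T‖ ≤ 1) {z : ℂ} (hz : ‖z‖ < 1)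
    {a b : ι} (hab : a ≠ b) {u : ℂ} (hu : ‖u‖ ≤ 1) :
    green (scaleRow a u T) z a b =
      u * (z * T (resolvent (scaleRow a 0 T) z (basisVec b)) a) / (1 - u * rowCoeff T z a) := by
  obtain ⟨s, h1, h2⟩ := resolvent_scaleRow hT hz a b hu
  have h3 := congrArg (fun x : L2 ι => x a) h1
  simp only [L2.add_apply, L2.smul_apply] at h3
  have e1 := green_scaleRow_zero hT hz a b
  have e2 := green_scaleRow_zero hT hz a a
  unfold green at e1 e2 ⊢
  rw [h3, e1, e2, if_neg hab, if_pos rfl, ← h2, eq_div_iff (one_sub_mul_rowCoeff_ne_zero hT hz a hu)]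
  unfold rowCoeff
  ring

theorem green_scaleRow_col {T : L2 ι →L[ℂ] L2 ι} (hT : ‖T‖ ≤ 1) {z : ℂ} (hz : ‖z‖ < 1)
    (c a : ι) {u : ℂ} (hu : ‖u‖ ≤ 1) :
    green (scaleRow a u T) z c a = green (scaleRow a 0 T) z c a / (1 - u * rowCoeff T z a) := by
  obtain ⟨s, h1, h2⟩ := resolvent_scaleRow hT hz a a hu
  have h3 := congrArg (fun x : L2 ι => x c) h1
  simp only [L2.add_apply, L2.smul_apply] at h3
  unfold green
  rw [h3, eq_div_iff (one_sub_mul_rowCoeff_ne_zero hT hz a hu)]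
  change s * (1 - u * rowCoeff T z a) = rowCoeff T z a at h2
  linear_combination u * (resolvent (scaleRow a 0 T) z (basisVec a)) c * h2

theorem green_scaleRow_diag {T : L2 ι →L[ℂ] L2 ι} (hT : ‖T‖ ≤ 1) {z : ℂ} (hz : ‖z‖ < 1)
    (a : ι) {u : ℂ} (hu : ‖u‖ ≤ 1) :
    green (scaleRow a u T) z a a = 1 / (1 - u * rowCoeff T z a) := by
  rw [green_scaleRow_col hT hz a a hu, green_scaleRow_zero hT hz, if_pos rfl]

end Resolvent

/-! ### Integrals over one uniform phase -/

section Circle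

/-- The number `e^{it}`. -/
def phase (t : ℝ) : ℂ := Complex.exp (Complex.I * t)

theorem continuous_phase : Continuous phase := by unfold phase; fun_prop

@[simp] theorem norm_phase (t : ℝ) : ‖phase t‖ = 1 := by
  rw [phase, mul_comm, Complex.norm_exp_ofReal_mul_I]

theorem phase_ne_zero (t : ℝ) : phase t ≠ 0 := Complex.exp_ne_zero _

/-- The uniform distribution on `[0, 2π)`. -/
def phaseMeasure : Measure ℝ := ProbabilityTheory.cond volume (Set.Ico 0 (2 * Real.pi))

theorem volume_Ico_two_pi : volume (Set.Ico 0 (2 * Real.pi)) = ENNReal.ofReal (2 * Real.pi) := by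
  simp

instance : IsProbabilityMeasure phaseMeasure :=
  cond_isProbabilityMeasure_of_finite (by simp [Real.pi_pos])
    (by rw [volume_Ico_two_pi]; exact ENNReal.ofReal_ne_top)

theorem phaseMeasure_eq : phaseMeasure =
    (ENNReal.ofReal (2 * Real.pi))⁻¹ • volume.restrict (Set.Ioc 0 (2 * Real.pi)) := by
  rw [phaseMeasure, ProbabilityTheory.cond, volume_Ico_two_pi, restrict_Ico_eq_restrict_Ioc]

theorem integral_phaseMeasure (f : ℝ → ℂ) :
    ∫ t, f t ∂phaseMeasure = (2 * Real.pi : ℂ)⁻¹ * ∫ t in 0..2 * Real.pi, f t := by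
  rw [phaseMeasure_eq, integral_smul_measure,
    ← intervalIntegral.integral_of_le (by positivity)]
  rw [ENNReal.toReal_inv, ENNReal.toReal_ofReal (by positivity)]
  simp

theorem integral_phase_zpow (k : ℤ) :
    ∫ t, phase t ^ k ∂phaseMeasure = if k = 0 then 1 else 0 := by
  split_ifs with h
  · simp [h]
  · rw [integral_phaseMeasure]
    have h1 : ∀ t : ℝ, phase t ^ k = Complex.exp ((k * Complex.I) * t) := fun t => by
      rw [phase, ← Complex.exp_int_mul]; ring_nf
    simp_rw [h1]
    rw [integral_exp_mul_complex (by simp [h])]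
    have h2 : Complex.exp (k * Complex.I * ((2 * Real.pi : ℝ) : ℂ)) = 1 := by
      rw [← Complex.exp_int_mul_two_pi_mul_I k]; congr 1; push_cast; ring
    rw [h2]; simp

theorem integral_phase_zpow_mul_tsum (a : ℕ → ℂ) (ha : Summable fun m => ‖a m‖) (n : ℤ) :
    ∫ t, phase t ^ (-n) * ∑' m, a m * phase t ^ m ∂phaseMeasure =
      if 0 ≤ n then a n.toNat else 0 := by
  simp_rw [← tsum_mul_left]
  have hint : ∀ m : ℕ, Integrable (fun t => phase t ^ (-n) * (a m * phase t ^ m)) phaseMeasure :=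
    fun m => by
      refine Integrable.of_bound (C := ‖a m‖) ?_ (Filter.Eventually.of_forall fun t => by simp)
      refine Continuous.aestronglyMeasurable ?_
      exact (continuous_phase.zpow₀ _ fun t => Or.inl (phase_ne_zero t)).mul
        (continuous_const.mul (continuous_phase.pow m))
  rw [← integral_tsum_of_summable_integral_norm hint (by simpa using ha)]
  have h1 : ∀ m : ℕ, ∫ t, phase t ^ (-n) * (a m * phase t ^ m) ∂phaseMeasure =
      if (m : ℤ) = n then a m else 0 := fun m => by
    have : ∀ t, phase t ^ (-n) * (a m * phase t ^ m) = a m * phase t ^ ((m : ℤ) - n) := fun t => by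
      rw [sub_eq_add_neg, zpow_add₀ (phase_ne_zero t), zpow_natCast]; ring
    simp_rw [this, integral_const_mul, integral_phase_zpow, sub_eq_zero]
    simp
  simp_rw [h1]
  split_ifs with h
  · rw [tsum_eq_single n.toNat]
    · simp [h]
    · intro m hm
      rw [if_neg]
      rintro rfl
      simp at hm
  · exact (tsum_congr fun m => if_neg (by omega)).trans tsum_zero

theorem cos_lower_bound (t : ℝ) (ht : 0 ≤ t) (c : ℝ) (hc : -1 ≤ c) (hc' : c ≤ 1) :
    (1 - c) / 2 ≤ 1 - 2 * t * c + t ^ 2 := by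
  rcases le_total c 0 with h | h
  · nlinarith [mul_nonneg ht (neg_nonneg.2 h)]
  · nlinarith [sq_nonneg (t - c), mul_nonneg (by linarith : 0 ≤ 2 * c + 1) (sub_nonneg.2 hc')]

/-- The bound depends on `ρ` only through its argument, which is a translation of `t`; this is what
makes the integral below bounded uniformly in `ρ`. -/
theorem norm_one_sub_phase_mul_sq_ge (ρ : ℂ) (t : ℝ) :
    (1 - Real.cos (t + ρ.arg)) / 2 ≤ ‖1 - phase t * ρ‖ ^ 2 := by
  refine (cos_lower_bound ‖ρ‖ (norm_nonneg _) _ (Real.neg_one_le_cos _)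
    (Real.cos_le_one _)).trans_eq ?_
  have h : phase t * ρ = ‖ρ‖ * Complex.exp (((t + ρ.arg : ℝ) : ℂ) * Complex.I) := by
    conv_lhs => rw [← Complex.norm_mul_exp_arg_mul_I ρ]
    rw [phase, mul_left_comm, ← Complex.exp_add]
    congr 2; push_cast; ring
  rw [h, ← Complex.normSq_eq_norm_sq (_ - _), Complex.exp_mul_I, ← Complex.ofReal_cos,
    ← Complex.ofReal_sin, Complex.normSq_apply]
  simp only [Complex.sub_re, Complex.sub_im, Complex.mul_re, Complex.mul_im, Complex.add_re,
    Complex.add_im, Complex.ofReal_re, Complex.ofReal_im, Complex.I_re, Complex.I_im,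
    Complex.one_re, Complex.one_im]
  nlinarith [Real.sin_sq_add_cos_sq (t + ρ.arg)]

theorem intervalIntegrable_abs_rpow_neg_half :
    IntervalIntegrable (fun x : ℝ => |x| ^ (-(1 / 2) : ℝ)) volume (-Real.pi) Real.pi := by
  have h : IntervalIntegrable (fun x : ℝ => |x| ^ (-(1 / 2) : ℝ)) volume 0 Real.pi := by
    refine (intervalIntegral.intervalIntegrable_rpow' (r := -(1 / 2)) (by norm_num)).congr ?_
    intro x hx
    rw [Set.uIoc_of_le Real.pi_pos.le] at hx
    simp [abs_of_pos hx.1]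
  refine IntervalIntegrable.trans ?_ h
  rw [IntervalIntegrable.iff_comp_neg]
  simpa using h.symm

theorem lintegral_cos_rpow_lt_top :
    ∫⁻ t in Set.Ioc (-Real.pi) (-Real.pi + 2 * Real.pi),
      ENNReal.ofReal ((1 - Real.cos t) / 2) ^ (-(1 / 4) : ℝ) < ∞ := by
  rw [show -Real.pi + 2 * Real.pi = Real.pi by ring]
  have h1 := (intervalIntegrable_iff_integrableOn_Ioc_of_le
    (by linarith [Real.pi_pos])).1 intervalIntegrable_abs_rpow_neg_half
  have h2 := (h1.const_mul ((1 / Real.pi ^ 2) ^ (-(1 / 4) : ℝ))).lintegral_lt_top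
  refine lt_of_le_of_lt ?_ h2
  refine setLIntegral_mono_ae' measurableSet_Ioc ?_
  have h0 : ∀ᵐ t : ℝ, t ≠ 0 := by simp [ae_iff]
  filter_upwards [h0] with t ht hmem
  -- A quadratic lower bound on `1 - cos t` turns the power `-1/4` into the integrable singularity
  -- `|t|^(-1/2)`.
  have hc := Real.cos_le_one_sub_mul_cos_sq (x := t) (abs_le.2 ⟨hmem.1.le, hmem.2⟩)
  have hpos : 0 < 1 / Real.pi ^ 2 * |t| ^ 2 := by positivity
  have hle : 1 / Real.pi ^ 2 * |t| ^ 2 ≤ (1 - Real.cos t) / 2 := by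
    rw [sq_abs]; linarith [show 2 / Real.pi ^ 2 * t ^ 2 = 2 * (1 / Real.pi ^ 2 * t ^ 2) by ring]
  rw [ENNReal.ofReal_rpow_of_pos (hpos.trans_le hle)]
  refine ENNReal.ofReal_le_ofReal ?_
  refine (Real.rpow_le_rpow_of_nonpos hpos hle (by norm_num)).trans_eq ?_
  rw [Real.mul_rpow (by positivity) (by positivity), ← Real.rpow_natCast |t|,
    ← Real.rpow_mul (abs_nonneg t)]
  norm_num

theorem exists_lintegral_phase_rpow_neg_half_le : ∃ K : ℝ≥0∞, K ≠ ∞ ∧ 1 ≤ K ∧ ∀ ρ : ℂ,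
    ∫⁻ t, ‖1 - phase t * ρ‖ₑ ^ (-(1 / 2) : ℝ) ∂phaseMeasure ≤ K := by
  set g : ℝ → ℝ≥0∞ := fun t => ENNReal.ofReal ((1 - Real.cos t) / 2) ^ (-(1 / 4) : ℝ) with hg
  have hper : ∀ t, g (t + 2 * Real.pi) = g t := fun t => by simp [hg]
  -- The maximum with `1` provides `1 ≤ K`, used for diagonal entries of the resolvent and for
  -- positivity of `K`.
  refine ⟨max 1 ((ENNReal.ofReal (2 * Real.pi))⁻¹ *
    ∫⁻ t in Set.Ioc (-Real.pi) (-Real.pi + 2 * Real.pi), g t), ?_, le_max_left _ _, fun ρ => ?_⟩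
  · refine (max_lt ENNReal.one_lt_top (ENNReal.mul_lt_top ?_ lintegral_cos_rpow_lt_top)).ne
    simp [Real.pi_pos]
  · refine le_trans ?_ (le_max_right _ _)
    rw [phaseMeasure_eq, lintegral_smul_measure, smul_eq_mul]
    refine mul_le_mul_right ?_ _
    have h1 : ∀ t, ‖1 - phase t * ρ‖ₑ ^ (-(1 / 2) : ℝ) ≤ g (t + ρ.arg) := fun t => by
      have h2 := ENNReal.ofReal_le_ofReal (norm_one_sub_phase_mul_sq_ge ρ t)
      rw [ENNReal.ofReal_pow (norm_nonneg _), ofReal_norm] at h2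
      have h3 := ENNReal.inv_le_inv.2 (ENNReal.rpow_le_rpow (z := (1 / 4 : ℝ)) h2 (by norm_num))
      rw [← ENNReal.rpow_neg, ← ENNReal.rpow_neg] at h3
      refine le_trans (le_of_eq ?_) h3
      rw [← ENNReal.rpow_natCast, ← ENNReal.rpow_mul]; norm_num
    refine (lintegral_mono h1).trans_eq ?_
    have h4 : ∫⁻ t in Set.Ioc 0 (2 * Real.pi), g (t + ρ.arg) =
        ∫⁻ t in Set.Ioc ρ.arg (ρ.arg + 2 * Real.pi), g t := by
      have := (measurePreserving_add_right volume ρ.arg).setLIntegral_comp_preimage_emb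
        (measurableEmbedding_addRight ρ.arg) g (Set.Ioc ρ.arg (ρ.arg + 2 * Real.pi))
      rw [← this]
      congr 2
      ext t
      simp
    rw [h4]
    have hT : 0 < 2 * Real.pi := by positivity
    refine (isAddFundamentalDomain_Ioc hT ρ.arg).setLIntegral_eq
      (isAddFundamentalDomain_Ioc hT (-Real.pi)) g ?_
    rintro ⟨x, n, rfl⟩ t
    have := (show Function.Periodic g (2 * Real.pi) from hper).zsmul n t
    rw [add_comm] at this
    exact this

/-- The mean of `1 - e^{it} ρ` is `1`, so its absolute value has mean at least `1`; boundedness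
passes this to the square root. -/
theorem half_le_lintegral_phase_rpow_half {ρ : ℂ} (hρ : ‖ρ‖ ≤ 1) :
    1 / 2 ≤ ∫⁻ t, ‖1 - phase t * ρ‖ₑ ^ (1 / 2 : ℝ) ∂phaseMeasure := by
  have h1 : ∫ t, (1 - phase t * ρ) ∂phaseMeasure = 1 := by
    have hi : Integrable (fun t => phase t * ρ) phaseMeasure :=
      Integrable.of_bound (C := ‖ρ‖)
        ((continuous_phase.mul continuous_const).aestronglyMeasurable)
        (Filter.Eventually.of_forall fun t => by simp)
    rw [integral_sub (integrable_const _) hi, integral_mul_const]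
    have := integral_phase_zpow 1
    simp only [zpow_one] at this
    simp [this]
  have h2 : 1 ≤ ∫⁻ t, ‖1 - phase t * ρ‖ₑ ∂phaseMeasure := by
    have := enorm_integral_le_lintegral_enorm (μ := phaseMeasure) (fun t => 1 - phase t * ρ)
    rwa [h1, enorm_one] at this
  have h3 : ∀ t, ‖1 - phase t * ρ‖ₑ ≤ 2 * ‖1 - phase t * ρ‖ₑ ^ (1 / 2 : ℝ) := fun t => by
    have hle : ‖1 - phase t * ρ‖ₑ ≤ 4 := by
      rw [← ofReal_norm, ← ENNReal.ofReal_ofNat]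
      refine ENNReal.ofReal_le_ofReal ((norm_sub_le _ _).trans ?_)
      simp; linarith
    have e : ‖1 - phase t * ρ‖ₑ = ‖1 - phase t * ρ‖ₑ ^ (1 / 2 : ℝ) *
        ‖1 - phase t * ρ‖ₑ ^ (1 / 2 : ℝ) := by
      rw [← ENNReal.rpow_add_of_nonneg _ _ (by norm_num) (by norm_num)]; norm_num
    conv_lhs => rw [e]
    gcongr
    refine (ENNReal.rpow_le_rpow hle (by norm_num)).trans_eq ?_
    rw [show (4 : ℝ≥0∞) = 2 ^ (2 : ℝ) by norm_num, ← ENNReal.rpow_mul]; norm_num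
  have h4 := h2.trans (lintegral_mono h3)
  rw [lintegral_const_mul' _ _ (by norm_num)] at h4
  rw [ENNReal.div_le_iff_le_mul (by simp) (by simp), mul_comm]
  exact h4

/-- Poisson kernel: `(1 - ‖w‖²) / ‖1 - w‖² = 2 Re (1 - w)⁻¹ - 1`, and the geometric series gives `(1
- e^{it} f)⁻¹` mean `1`. -/
theorem lintegral_phase_sq_inv_le {f : ℂ} (hf : ‖f‖ < 1) :
    ∫⁻ t, ENNReal.ofReal (1 / ‖1 - phase t * f‖ ^ 2) ∂phaseMeasure ≤
      ENNReal.ofReal (1 / (1 - ‖f‖ ^ 2)) := by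
  have hlt : ∀ t, ‖phase t * f‖ < 1 := fun t => by simpa using hf
  have hne : ∀ t, 1 - phase t * f ≠ 0 := fun t h => by
    have := hlt t
    rw [← sub_eq_zero.1 h] at this
    simp at this
  have hsq : 0 < 1 - ‖f‖ ^ 2 := by nlinarith [norm_nonneg f]
  have hc : Continuous fun t => (1 - phase t * f)⁻¹ :=
    (continuous_const.sub (continuous_phase.mul continuous_const)).inv₀ hne
  have hbd : ∀ t, ‖(1 - phase t * f)⁻¹‖ ≤ (1 - ‖f‖)⁻¹ := fun t => by
    rw [norm_inv]
    refine inv_anti₀ (by linarith) ?_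
    have := norm_sub_norm_le (1 : ℂ) (phase t * f)
    simpa using this
  have hi : Integrable (fun t => (1 - phase t * f)⁻¹) phaseMeasure :=
    Integrable.of_bound hc.aestronglyMeasurable (C := (1 - ‖f‖)⁻¹)
      (Filter.Eventually.of_forall hbd)
  have h1 : ∫ t, (1 - phase t * f)⁻¹ ∂phaseMeasure = 1 := by
    have := integral_phase_zpow_mul_tsum (fun m => f ^ m)
      (by simpa using summable_geometric_of_lt_one (norm_nonneg f) hf) 0
    simp only [neg_zero, zpow_zero, one_mul, le_refl, if_true, Int.toNat_zero, pow_zero] at this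
    refine Eq.trans ?_ this
    refine integral_congr_ae (Filter.Eventually.of_forall fun t => ?_)
    change (1 - phase t * f)⁻¹ = ∑' m : ℕ, f ^ m * phase t ^ m
    rw [← tsum_geometric_of_norm_lt_one (hlt t)]
    exact tsum_congr fun m => by ring
  have hpt : ∀ t, 1 / ‖1 - phase t * f‖ ^ 2 =
      (1 / (1 - ‖f‖ ^ 2)) * (2 * ((1 - phase t * f)⁻¹).re - 1) := fun t => by
    have hn : ‖phase t * f‖ ^ 2 = ‖f‖ ^ 2 := by simp
    have hpos : 0 < ‖1 - phase t * f‖ ^ 2 := by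
      have := norm_pos_iff.2 (hne t); positivity
    rw [Complex.inv_re, Complex.normSq_eq_norm_sq, ← hn]
    rw [← hn] at hsq
    rw [← Complex.normSq_eq_norm_sq (phase t * f)] at hsq ⊢
    rw [← Complex.normSq_eq_norm_sq] at hpos ⊢
    field_simp
    rw [Complex.normSq_apply, Complex.normSq_apply]
    simp
    ring
  have hre : Integrable (fun t => ((1 - phase t * f)⁻¹).re) phaseMeasure := hi.re
  have h2 : ∫ t, (1 / ‖1 - phase t * f‖ ^ 2) ∂phaseMeasure = 1 / (1 - ‖f‖ ^ 2) := by
    simp_rw [hpt]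
    rw [integral_const_mul, integral_sub (hre.const_mul 2) (integrable_const _),
      integral_const_mul]
    have h3 : ∫ t, ((1 - phase t * f)⁻¹).re ∂phaseMeasure = 1 := by
      have := integral_re hi
      simp only [RCLike.re_eq_complex_re] at this
      rw [this, h1]; simp
    rw [h3]; simp; norm_num
  rw [← ofReal_integral_eq_lintegral_ofReal, h2]
  · simp_rw [hpt]
    exact ((hre.const_mul 2).sub (integrable_const _)).const_mul _
  · exact Filter.Eventually.of_forall fun t => by positivity

end Circle

/-! ### Averaging over one coordinate of a product measure -/

section Resampling

variable {ι : Type*} [DecidableEq ι] {X : Type*} [MeasurableSpace X]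

theorem measurable_update_prod (a : ι) :
    Measurable fun p : (ι → X) × X => Function.update p.1 a p.2 := by
  refine measurable_pi_lambda _ fun i => ?_
  by_cases h : i = a
  · subst h; simpa using measurable_snd
  · simpa [Function.update_of_ne h, Function.comp_def] using
      (measurable_pi_apply (X := fun _ : ι => X) i).comp measurable_fst

/-- A product measure is invariant under resampling of one coordinate. -/
theorem map_update_infinitePi (μ : Measure X) [IsProbabilityMeasure μ] (a : ι) :
    ((Measure.infinitePi fun _ : ι => μ).prod μ).map
      (fun p : (ι → X) × X => Function.update p.1 a p.2) = Measure.infinitePi fun _ : ι => μ := by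
  refine Measure.eq_infinitePi _ fun s t ht => ?_
  rw [Measure.map_apply (measurable_update_prod a)
    (MeasurableSet.pi s.countable_toSet fun i _ => ht i)]
  by_cases has : a ∈ s
  · have h : (fun p : (ι → X) × X => Function.update p.1 a p.2) ⁻¹' (Set.pi s t) =
        (Set.pi (s.erase a : Finset ι) t) ×ˢ t a := by
      ext p
      simp only [Set.mem_preimage, Set.mem_pi, Set.mem_prod, Finset.mem_coe, Finset.mem_erase]
      constructor
      · intro h
        refine ⟨fun i hi => ?_, ?_⟩
        · simpa [Function.update_of_ne hi.1] using h i hi.2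
        · simpa using h a has
      · rintro ⟨h1, h2⟩ i hi
        by_cases hia : i = a
        · subst hia; simpa using h2
        · simpa [Function.update_of_ne hia] using h1 i ⟨hia, hi⟩
    rw [h, Measure.prod_prod, Measure.infinitePi_pi _ fun i _ => ht i,
      Finset.prod_erase_mul _ _ has]
  · have h : (fun p : (ι → X) × X => Function.update p.1 a p.2) ⁻¹' (Set.pi s t) =
        (Set.pi s t) ×ˢ Set.univ := by
      ext p
      simp only [Set.mem_preimage, Set.mem_pi, Set.mem_prod, Finset.mem_coe, Set.mem_univ, and_true]
      refine forall₂_congr fun i hi => ?_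
      rw [Function.update_of_ne (ne_of_mem_of_not_mem hi has)]
    rw [h, Measure.prod_prod, Measure.infinitePi_pi _ fun i _ => ht i, measure_univ, mul_one]

/-- This replaces conditional expectation given all other phases: one-phase estimates, proved with
the other phases fixed, can be integrated afterwards. -/
theorem lintegral_resample {Ω : Type*} [MeasurableSpace Ω] {P : Measure Ω}
    {μ : Measure X} [IsProbabilityMeasure μ] {ω : ι → Ω → X} (hω : ∀ a, Measurable (ω a))
    (hlaw : P.map (fun w a => ω a w) = Measure.infinitePi fun _ : ι => μ) (a : ι)
    {F : (ι → X) → ℝ≥0∞} (hF : Measurable F) :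
    ∫⁻ w, F (fun a => ω a w) ∂P =
      ∫⁻ w, ∫⁻ t, F (Function.update (fun a => ω a w) a t) ∂μ ∂P := by
  have hm : Measurable fun w a => ω a w := measurable_pi_lambda _ hω
  have hFu := hF.comp (measurable_update_prod (X := X) a)
  rw [← lintegral_map (f := F) hF hm, hlaw,
    ← lintegral_map (f := fun θ => ∫⁻ t, F (Function.update θ a t) ∂μ) ?_ hm, hlaw]
  · conv_lhs => rw [← map_update_infinitePi μ a]
    rw [lintegral_map hF (measurable_update_prod a), lintegral_prod]
    exact hFu.aemeasurable
  · exact hFu.lintegral_prod_right'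

end Resampling

/-! ### Moments of resolvent entries in one or two phases -/

section SinglePhase

variable {ι : Type*} [DecidableEq ι]

/-- The adjoint resolvent applied to a basis vector: the conjugate of a row of the resolvent. -/
def greenRow (T : L2 ι →L[ℂ] L2 ι) (z : ℂ) (a : ι) : L2 ι :=
  ContinuousLinearMap.adjoint (resolvent T z) (basisVec a)

theorem greenRow_apply (T : L2 ι →L[ℂ] L2 ι) (z : ℂ) (a b : ι) :
    greenRow T z a b = starRingEnd ℂ (green T z a b) := by
  rw [← inner_basisVec_left, greenRow, ContinuousLinearMap.adjoint_inner_right,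
    ← inner_conj_symm, inner_basisVec_left, green]

theorem hasSum_inner_greenRow (T : L2 ι →L[ℂ] L2 ι) (z : ℂ) (a b : ι) :
    HasSum (fun c => green T z a c * starRingEnd ℂ (green T z b c))
      (inner ℂ (greenRow T z a) (greenRow T z b)) := by
  have h := lp.hasSum_inner (𝕜 := ℂ) (greenRow T z a) (greenRow T z b)
  have e : ∀ c, inner ℂ (greenRow T z a c) (greenRow T z b c) =
      green T z a c * starRingEnd ℂ (green T z b c) := fun c => by
    rw [greenRow_apply, greenRow_apply, RCLike.inner_apply]
    simp [mul_comm]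
  simpa only [e] using h

/-- The resolvent identity for an operator with isometric adjoint. -/
theorem inner_greenRow {T : L2 ι →L[ℂ] L2 ι} (hT : ‖T‖ ≤ 1)
    (hT' : ∀ x y, inner ℂ (ContinuousLinearMap.adjoint T x) (ContinuousLinearMap.adjoint T y) =
      inner ℂ x y) {z : ℂ} (hz : ‖z‖ < 1) (a b : ι) :
    (1 - ‖z‖ ^ 2 : ℂ) * inner ℂ (greenRow T z a) (greenRow T z b) =
      green T z a b + starRingEnd ℂ (green T z b a) - if a = b then 1 else 0 := by
  -- This is the adjoint of `R (1 - z T) = 1` applied to `e_c`. Since the adjoint of `T` preserves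
  -- inner products, pairing the relations for `a` and `b` eliminates `T`.
  have hrow : ∀ c, greenRow T z c - basisVec c =
      starRingEnd ℂ z • ContinuousLinearMap.adjoint T (greenRow T z c) := fun c => by
    have h := geom_series_mul_neg (z • T) (norm_smul_lt_one hT hz)
    have h2 := congrArg (fun S => ContinuousLinearMap.adjoint S (basisVec c)) h
    change ContinuousLinearMap.adjoint ((resolvent T z).comp (1 - z • T)) (basisVec c) =
      ContinuousLinearMap.adjoint (1 : L2 ι →L[ℂ] L2 ι) (basisVec c) at h2
    rw [ContinuousLinearMap.adjoint_comp, map_sub, map_smulₛₗ] at h2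
    have h1 : ContinuousLinearMap.adjoint (1 : L2 ι →L[ℂ] L2 ι) = 1 :=
      ContinuousLinearMap.adjoint_id
    rw [h1] at h2
    simp only [ContinuousLinearMap.comp_apply, sub_apply, one_apply_eq_self, smul_apply] at h2
    change greenRow T z c - starRingEnd ℂ z • ContinuousLinearMap.adjoint T (greenRow T z c) =
      basisVec c at h2
    rw [← h2]; abel
  have h3 : inner ℂ (greenRow T z a - basisVec a) (greenRow T z b - basisVec b) =
      (‖z‖ ^ 2 : ℂ) * inner ℂ (greenRow T z a) (greenRow T z b) := by
    rw [hrow a, hrow b, inner_smul_left, inner_smul_right, hT', Complex.conj_conj, ← mul_assoc,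
      Complex.mul_conj, Complex.normSq_eq_norm_sq]
    push_cast; rfl
  rw [inner_sub_left, inner_sub_right, inner_sub_right, inner_basisVec_left, inner_basisVec_left,
    ← inner_conj_symm (greenRow T z a) (basisVec b), inner_basisVec_left, greenRow_apply,
    greenRow_apply, basisVec_apply, Complex.conj_conj] at h3
  linear_combination h3

theorem norm_greenRow_sq {T : L2 ι →L[ℂ] L2 ι} (hT : ‖T‖ ≤ 1)
    (hT' : ∀ x y, inner ℂ (ContinuousLinearMap.adjoint T x) (ContinuousLinearMap.adjoint T y) =
      inner ℂ x y) {z : ℂ} (hz : ‖z‖ < 1) (a : ι) :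
    (1 - ‖z‖ ^ 2) * ‖greenRow T z a‖ ^ 2 = 2 * (green T z a a).re - 1 := by
  have h := congrArg Complex.re (inner_greenRow hT hT' hz a a)
  rw [inner_self_eq_norm_sq_to_K, if_pos rfl] at h
  have e : ((1 - ‖z‖ ^ 2 : ℂ) * ((‖greenRow T z a‖ : ℝ) : ℂ) ^ 2) =
      (((1 - ‖z‖ ^ 2) * ‖greenRow T z a‖ ^ 2 : ℝ) : ℂ) := by push_cast; ring
  have h' : ((1 - ‖z‖ ^ 2 : ℂ) * ((‖greenRow T z a‖ : ℝ) : ℂ) ^ 2).re =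
      (green T z a a + starRingEnd ℂ (green T z a a) - 1).re := h
  rw [e, Complex.ofReal_re] at h'
  rw [h']
  simp
  ring

/-- The inequality between `h` and `f` encodes unitarity: one entry of a row is at most the norm of
the row, which `norm_greenRow_sq` expresses through the diagonal entry `1 / (1 - f)`. -/
theorem norm_green_scaleRow {T : L2 ι →L[ℂ] L2 ι} (hT : ‖T‖ ≤ 1)
    (hT' : ∀ x y, inner ℂ (ContinuousLinearMap.adjoint T x) (ContinuousLinearMap.adjoint T y) =
      inner ℂ x y) {z : ℂ} (hz : ‖z‖ < 1) (a b : ι) :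
    ∃ h f : ℂ, ‖f‖ ≤ ‖z‖ ∧ (1 - ‖z‖ ^ 2) * ‖h‖ ^ 2 ≤ 1 - ‖f‖ ^ 2 ∧
      ∀ t, ‖green (scaleRow a (phase t) T) z a b‖ = ‖h‖ / ‖1 - phase t * f‖ := by
  have hf := norm_rowCoeff_le hT hz a
  set f := rowCoeff T z a with hfdef
  obtain ⟨h, hh⟩ : ∃ h : ℂ, ∀ u : ℂ, ‖u‖ = 1 →
      ‖green (scaleRow a u T) z a b‖ = ‖h‖ / ‖1 - u * f‖ := by
    by_cases hab : a = b
    · subst hab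
      refine ⟨1, fun u hu => ?_⟩
      rw [green_scaleRow_diag hT hz a hu.le, norm_div]
    · refine ⟨z * T (resolvent (scaleRow a 0 T) z (basisVec b)) a, fun u hu => ?_⟩
      rw [green_scaleRow_row hT hz hab hu.le, norm_div, norm_mul, hu, one_mul]
  refine ⟨h, f, hf, ?_, fun t => hh _ (norm_phase t)⟩
  -- As `h` and `f` do not depend on `u`, it suffices to compare them at `u = 1`, where the operator
  -- is `T` itself.
  have hT1 : scaleRow a 1 T = T := by ext x c; simp [scaleRow_apply]
  have hne := one_sub_mul_rowCoeff_ne_zero hT hz a (u := 1) (by simp)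
  have h1 := norm_greenRow_sq hT hT' hz a
  have h2 := norm_apply_le (greenRow T z a) b
  rw [greenRow_apply, RCLike.norm_conj] at h2
  have h3 := hh 1 (by simp)
  have h4 := green_scaleRow_diag hT hz a (u := 1) (by simp)
  rw [hT1] at h3 h4
  rw [← hfdef, one_mul] at hne h4
  rw [one_mul] at h3
  have hpos : 0 < ‖1 - f‖ ^ 2 := by have := norm_pos_iff.2 hne; positivity
  have hz2 : 0 ≤ 1 - ‖z‖ ^ 2 := by nlinarith [norm_nonneg z]
  have h5 : (1 - ‖z‖ ^ 2) * (‖h‖ / ‖1 - f‖) ^ 2 ≤ (1 - ‖f‖ ^ 2) / ‖1 - f‖ ^ 2 := by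
    have e : 2 * (green T z a a).re - 1 = (1 - ‖f‖ ^ 2) / ‖1 - f‖ ^ 2 := by
      rw [h4, one_div, Complex.inv_re, ← Complex.normSq_eq_norm_sq, ← Complex.normSq_eq_norm_sq]
      rw [← Complex.normSq_eq_norm_sq] at hpos
      field_simp
      rw [Complex.normSq_apply, Complex.normSq_apply]
      simp
      ring
    rw [← e, ← h1, ← h3]
    gcongr
  rwa [div_pow, ← mul_div_assoc, div_le_div_iff_of_pos_right hpos] at h5

theorem half_le_enorm_rpow_neg_half {w : ℂ} (hw : ‖w‖ ≤ 1) :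
    2⁻¹ ≤ ‖1 - w‖ₑ ^ (-(1 / 2) : ℝ) := by
  rw [ENNReal.rpow_neg]
  refine ENNReal.inv_le_inv.2 ?_
  have hle : ‖1 - w‖ₑ ≤ 4 := by
    rw [← ofReal_norm, ← ENNReal.ofReal_ofNat]
    refine ENNReal.ofReal_le_ofReal ((norm_sub_le _ _).trans ?_)
    simp; linarith
  refine (ENNReal.rpow_le_rpow hle (by norm_num)).trans_eq ?_
  rw [show (4 : ℝ≥0∞) = 2 ^ (2 : ℝ) by norm_num, ← ENNReal.rpow_mul]; norm_num

theorem enorm_rpow_half_of_norm_eq {g h w : ℂ} (hw : w ≠ 0) (hg : ‖g‖ = ‖h‖ / ‖w‖) :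
    ‖g‖ₑ ^ (1 / 2 : ℝ) = ‖h‖ₑ ^ (1 / 2 : ℝ) * ‖w‖ₑ ^ (-(1 / 2) : ℝ) := by
  have h1 : ‖g‖ₑ = ‖h‖ₑ * ‖w‖ₑ⁻¹ := by
    rw [← ofReal_norm, hg, ENNReal.ofReal_div_of_pos (norm_pos_iff.2 hw), ofReal_norm, ofReal_norm,
      div_eq_mul_inv]
  rw [h1, ENNReal.mul_rpow_of_nonneg _ _ (by norm_num), ENNReal.rpow_neg, ENNReal.inv_rpow]

theorem one_sub_phase_mul_ne_zero {f : ℂ} (hf : ‖f‖ < 1) (t : ℝ) : 1 - phase t * f ≠ 0 := by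
  intro h
  have h1 : ‖phase t * f‖ = 1 := by rw [← sub_eq_zero.1 h]; simp
  simp at h1
  linarith

theorem measurable_enorm_one_sub_phase_mul_rpow (ρ : ℂ) (s : ℝ) :
    Measurable fun t => ‖1 - phase t * ρ‖ₑ ^ s :=
  ((continuous_const.sub (continuous_phase.mul continuous_const)).measurable.enorm).pow_const s

theorem lintegral_green_scaleRow_le {K : ℝ≥0∞} (hK : ∀ ρ : ℂ,
    ∫⁻ t, ‖1 - phase t * ρ‖ₑ ^ (-(1 / 2) : ℝ) ∂phaseMeasure ≤ K)
    {T : L2 ι →L[ℂ] L2 ι} (hT : ‖T‖ ≤ 1) {z : ℂ} (hz : ‖z‖ < 1) (c a : ι) :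
    ∫⁻ t, ‖green (scaleRow a (phase t) T) z c a‖ₑ ^ (1 / 2 : ℝ) ∂phaseMeasure ≤
      K * ‖green (scaleRow a 0 T) z c a‖ₑ ^ (1 / 2 : ℝ) := by
  have hf := (norm_rowCoeff_le hT hz a).trans_lt hz
  have h1 : ∀ t, ‖green (scaleRow a (phase t) T) z c a‖ₑ ^ (1 / 2 : ℝ) =
      ‖green (scaleRow a 0 T) z c a‖ₑ ^ (1 / 2 : ℝ) *
        ‖1 - phase t * rowCoeff T z a‖ₑ ^ (-(1 / 2) : ℝ) := fun t =>
    enorm_rpow_half_of_norm_eq (one_sub_phase_mul_ne_zero hf t)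
      (by rw [green_scaleRow_col hT hz c a (norm_phase t).le, norm_div])
  simp_rw [h1]
  rw [lintegral_const_mul _ (measurable_enorm_one_sub_phase_mul_rpow _ _), mul_comm]
  gcongr
  exact hK _

/-- Averaging over the phase at `b` deletes row `b` at the cost of `K`. The numerator that remains
in the formula for row `a` is then at most `1` by `norm_row_sq_le`, and the phase at `a` costs
another `K`. -/
theorem lintegral_green_scaleRow_two_le {K : ℝ≥0∞} (hK : ∀ ρ : ℂ,
    ∫⁻ t, ‖1 - phase t * ρ‖ₑ ^ (-(1 / 2) : ℝ) ∂phaseMeasure ≤ K)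
    {T : L2 ι →L[ℂ] L2 ι} (hT : ‖T‖ ≤ 1) {z : ℂ} (hz : ‖z‖ < 1) {a b : ι} (hab : a ≠ b) :
    ∫⁻ s, ∫⁻ t, ‖green (scaleRow b (phase t) (scaleRow a (phase s) T)) z a b‖ₑ ^ (1 / 2 : ℝ)
      ∂phaseMeasure ∂phaseMeasure ≤ K * K := by
  have hT0 := norm_scaleRow_le b (u := 0) (by simp) hT
  set S := scaleRow b 0 T with hS
  have hf := (norm_rowCoeff_le hT0 hz a).trans_lt hz
  have hb : green (scaleRow a 0 S) z b b = 1 := by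
    rw [hS, scaleRow_comm hab, green_scaleRow_zero (norm_scaleRow_le a (by simp) hT) hz,
      if_pos rfl]
  have h1 : ∀ s, ∫⁻ t, ‖green (scaleRow b (phase t) (scaleRow a (phase s) T)) z a b‖ₑ ^ (1 / 2 : ℝ)
      ∂phaseMeasure ≤ K * ‖1 - phase s * rowCoeff S z a‖ₑ ^ (-(1 / 2) : ℝ) := fun s => by
    refine (lintegral_green_scaleRow_le hK (norm_scaleRow_le a (norm_phase s).le hT) hz a b).trans ?_
    gcongr
    rw [scaleRow_comm hab.symm, ← hS]
    have e := enorm_rpow_half_of_norm_eq (one_sub_phase_mul_ne_zero hf s)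
      (show ‖green (scaleRow a (phase s) S) z a b‖ =
        ‖z * S (resolvent (scaleRow a 0 S) z (basisVec b)) a‖ / ‖1 - phase s * rowCoeff S z a‖ by
        rw [green_scaleRow_row hT0 hz hab (norm_phase s).le, norm_div, norm_mul, norm_phase,
          one_mul])
    rw [e]
    refine mul_le_of_le_one_left' ?_
    refine ENNReal.rpow_le_one ?_ (by norm_num)
    rw [← ofReal_norm]
    exact ENNReal.ofReal_le_one.2 ((norm_row_sq_le hT0 hz a b hb).trans hz.le)
  refine (lintegral_mono h1).trans ?_
  rw [lintegral_const_mul _ (measurable_enorm_one_sub_phase_mul_rpow _ _)]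
  gcongr
  exact hK _

/-- Decoupling of a factor which is affine in the phase of the row `a`. -/
theorem lintegral_green_scaleRow_decouple {K : ℝ≥0∞} (hK : ∀ ρ : ℂ,
    ∫⁻ t, ‖1 - phase t * ρ‖ₑ ^ (-(1 / 2) : ℝ) ∂phaseMeasure ≤ K)
    {T : L2 ι →L[ℂ] L2 ι} (hT : ‖T‖ ≤ 1)
    (hT' : ∀ x y, inner ℂ (ContinuousLinearMap.adjoint T x) (ContinuousLinearMap.adjoint T y) =
      inner ℂ x y) {z : ℂ} (hz : ‖z‖ < 1) (a b : ι) {ζ : ℂ} (hζ : ‖ζ‖ ≤ 1) :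
    ∫⁻ t, ‖green (scaleRow a (phase t) T) z a b‖ₑ ^ (1 / 2 : ℝ) ∂phaseMeasure ≤
      4 * K * ∫⁻ t, ‖(1 - phase t * ζ) * green (scaleRow a (phase t) T) z a b‖ₑ ^ (1 / 2 : ℝ)
        ∂phaseMeasure := by
  obtain ⟨h, f, hfz, -, hg⟩ := norm_green_scaleRow hT hT' hz a b
  have hf := hfz.trans_lt hz
  have h1 : ∀ t, ‖green (scaleRow a (phase t) T) z a b‖ₑ ^ (1 / 2 : ℝ) =
      ‖h‖ₑ ^ (1 / 2 : ℝ) * ‖1 - phase t * f‖ₑ ^ (-(1 / 2) : ℝ) := fun t =>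
    enorm_rpow_half_of_norm_eq (one_sub_phase_mul_ne_zero hf t) (hg t)
  -- One factor `1/2` bounds `‖1 - e^{it} f‖^{-1/2}` pointwise from below, the other bounds the mean
  -- of `‖1 - e^{it} ζ‖^{1/2}`; together they give the constant `4`.
  have h2 : ‖h‖ₑ ^ (1 / 2 : ℝ) * 2⁻¹ * 2⁻¹ ≤
      ∫⁻ t, ‖(1 - phase t * ζ) * green (scaleRow a (phase t) T) z a b‖ₑ ^ (1 / 2 : ℝ)
        ∂phaseMeasure := by
    have hh := half_le_lintegral_phase_rpow_half hζ
    rw [one_div] at hh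
    refine (mul_le_mul_right hh _).trans ?_
    rw [← lintegral_const_mul _ (measurable_enorm_one_sub_phase_mul_rpow _ _)]
    refine lintegral_mono fun t => ?_
    rw [enorm_mul, ENNReal.mul_rpow_of_nonneg _ _ (by norm_num), h1, mul_comm]
    gcongr
    exact half_le_enorm_rpow_neg_half (by simpa using hf.le)
  have h3 : ∫⁻ t, ‖green (scaleRow a (phase t) T) z a b‖ₑ ^ (1 / 2 : ℝ) ∂phaseMeasure ≤
      K * ‖h‖ₑ ^ (1 / 2 : ℝ) := by
    simp_rw [h1]
    rw [lintegral_const_mul _ (measurable_enorm_one_sub_phase_mul_rpow _ _), mul_comm]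
    gcongr
    exact hK _
  refine h3.trans ((mul_le_mul_right h2 (4 * K)).trans' (le_of_eq ?_))
  have h4 : (4 : ℝ≥0∞) * 2⁻¹ * 2⁻¹ = 1 := by
    rw [show (4 : ℝ≥0∞) = 2 * 2 by norm_num, mul_assoc 2 2, ENNReal.mul_inv_cancel (by simp) (by simp),
      mul_one, ENNReal.mul_inv_cancel (by simp) (by simp)]
  calc K * ‖h‖ₑ ^ (1 / 2 : ℝ) = K * ‖h‖ₑ ^ (1 / 2 : ℝ) * ((4 : ℝ≥0∞) * 2⁻¹ * 2⁻¹) := by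
        rw [h4, mul_one]
    _ = _ := by ring

/-- The second moment, with a weight that compensates its divergence, is bounded by a fractional
moment. -/
theorem lintegral_green_scaleRow_sq_le {T : L2 ι →L[ℂ] L2 ι} (hT : ‖T‖ ≤ 1)
    (hT' : ∀ x y, inner ℂ (ContinuousLinearMap.adjoint T x) (ContinuousLinearMap.adjoint T y) =
      inner ℂ x y) {z : ℂ} (hz : ‖z‖ < 1) (a b : ι) :
    ENNReal.ofReal (1 - ‖z‖ ^ 2) *
        ∫⁻ t, ‖green (scaleRow a (phase t) T) z a b‖ₑ ^ 2 ∂phaseMeasure ≤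
      2 * ∫⁻ t, ‖green (scaleRow a (phase t) T) z a b‖ₑ ^ (1 / 2 : ℝ) ∂phaseMeasure := by
  obtain ⟨h, f, hfz, hhf, hg⟩ := norm_green_scaleRow hT hT' hz a b
  have hf := hfz.trans_lt hz
  have hz2 : 0 < 1 - ‖z‖ ^ 2 := by nlinarith [norm_nonneg z]
  have hf2 : 0 < 1 - ‖f‖ ^ 2 := by nlinarith [norm_nonneg f]
  have hfz2 : 1 - ‖z‖ ^ 2 ≤ 1 - ‖f‖ ^ 2 := by nlinarith [norm_nonneg f]
  have h1 : ∫⁻ t, ‖green (scaleRow a (phase t) T) z a b‖ₑ ^ 2 ∂phaseMeasure ≤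
      ENNReal.ofReal (‖h‖ ^ 2 * (1 / (1 - ‖f‖ ^ 2))) := by
    have e : ∀ t, ‖green (scaleRow a (phase t) T) z a b‖ₑ ^ 2 =
        ENNReal.ofReal (‖h‖ ^ 2) * ENNReal.ofReal (1 / ‖1 - phase t * f‖ ^ 2) := fun t => by
      rw [← ofReal_norm, hg, ← ENNReal.ofReal_pow (by positivity),
        ← ENNReal.ofReal_mul (by positivity), div_pow, mul_one_div]
    simp_rw [e]
    rw [lintegral_const_mul' _ _ ENNReal.ofReal_ne_top, ENNReal.ofReal_mul (by positivity)]
    gcongr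
    exact lintegral_phase_sq_inv_le hf
  have h2 : ‖h‖ₑ ^ (1 / 2 : ℝ) ≤
      2 * ∫⁻ t, ‖green (scaleRow a (phase t) T) z a b‖ₑ ^ (1 / 2 : ℝ) ∂phaseMeasure := by
    rw [← ENNReal.inv_mul_le_iff (by simp) (by simp), ← mul_one (2⁻¹ * _),
      ← measure_univ (μ := phaseMeasure), ← lintegral_const]
    refine lintegral_mono fun t => ?_
    rw [enorm_rpow_half_of_norm_eq (one_sub_phase_mul_ne_zero hf t) (hg t), mul_comm]
    gcongr
    exact half_le_enorm_rpow_neg_half (by simpa using hf.le)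
  refine le_trans ?_ h2
  refine (mul_le_mul_right h1 _).trans ?_
  rw [← ENNReal.ofReal_mul hz2.le, ← ofReal_norm, ENNReal.ofReal_rpow_of_nonneg (norm_nonneg _)
    (by norm_num)]
  refine ENNReal.ofReal_le_ofReal ?_
  rw [mul_one_div, ← mul_div_assoc, div_le_iff₀ hf2]
  -- For `‖h‖ ≤ 1` use `‖h‖² ≤ ‖h‖^{1/2}` and `‖f‖ ≤ ‖z‖`; for `‖h‖ ≥ 1` the unitarity bound `hhf`
  -- replaces the square.
  rcases le_total ‖h‖ 1 with hh | hh
  · have h5 : ‖h‖ ^ 2 ≤ ‖h‖ ^ (1 / 2 : ℝ) := by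
      rw [← Real.rpow_natCast]
      exact Real.rpow_le_rpow_of_exponent_ge' (norm_nonneg _) hh (by norm_num) (by norm_num)
    rw [mul_comm]
    gcongr
  · exact hhf.trans (le_mul_of_one_le_left hf2.le (Real.one_le_rpow hh (by norm_num)))

end SinglePhase

/-! ### The resolvent equation of the walk around unperturbed cycles -/

section Walk

/-- The quantum walk as a continuous linear map. -/
def walkOp (θ : Site × Fin 3 → ℝ) (C : Matrix.unitaryGroup (Fin 3) ℂ) :
    L2 (Site × Fin 3) →L[ℂ] L2 (Site × Fin 3) :=
  ((walk θ C).toContinuousLinearEquiv : H →L[ℂ] H)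

variable {θ : Site × Fin 3 → ℝ} {C : Matrix.unitaryGroup (Fin 3) ℂ}

theorem walkOp_eq_walk (f : H) : walkOp θ C f = walk θ C f := rfl

theorem walkOp_apply (f : H) (x : Site) (i : Fin 3) :
    walkOp θ C f (x, i) =
      phase (θ (x, i)) * ∑ j, (C : Matrix (Fin 3) (Fin 3) ℂ) i j * f (shiftInv i x, j) := rfl

theorem norm_walkOp_le : ‖walkOp θ C‖ ≤ 1 :=
  ContinuousLinearMap.opNorm_le_bound _ zero_le_one fun x => by
    rw [one_mul, walkOp_eq_walk, LinearIsometryEquiv.norm_map]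

theorem inner_adjoint_walkOp (x y : H) :
    inner ℂ (ContinuousLinearMap.adjoint (walkOp θ C) x)
      (ContinuousLinearMap.adjoint (walkOp θ C) y) = inner ℂ x y := by
  have h : ContinuousLinearMap.adjoint (walkOp θ C) =
      ((walk θ C).symm.toContinuousLinearEquiv : H →L[ℂ] H) :=
    LinearIsometryEquiv.adjoint_eq_symm (walk θ C)
  rw [h]
  exact (walk θ C).symm.inner_map_map x y

theorem walkOp_update (a : Site × Fin 3) (t : ℝ) :
    walkOp (Function.update θ a t) C = scaleRow a (phase t) (walkOp (Function.update θ a 0) C) := by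
  ext f c
  by_cases h : c = a
  · subst h
    rw [scaleRow_apply_self]
    obtain ⟨x, i⟩ := c
    rw [walkOp_apply, walkOp_apply]
    simp [phase]
  · rw [scaleRow_apply_ne h]
    obtain ⟨x, i⟩ := c
    rw [walkOp_apply, walkOp_apply, Function.update_of_ne h, Function.update_of_ne h]

/-- The labels coupled to `c` by the walk. -/
def source (e : Fin 3) (c : Site × Fin 3) : Site × Fin 3 := (shiftInv c.2 c.1, c.2 + e)

theorem green_walkOp_eq {z : ℂ} (hz : ‖z‖ < 1) (c b : Site × Fin 3) :
    green (walkOp θ C) z c b = (if c = b then 1 else 0) + z * (phase (θ c) *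
      ∑ e, (C : Matrix (Fin 3) (Fin 3) ℂ) c.2 (c.2 + e) *
        green (walkOp θ C) z (source e c) b) := by
  rw [green_eq norm_walkOp_le hz]
  obtain ⟨x, i⟩ := c
  rw [walkOp_apply]
  have h : ∀ f : Fin 3 → ℂ, ∑ j, f j = ∑ e, f (i + e) := fun f =>
    (Fintype.sum_equiv (Equiv.addLeft i) _ _ fun _ => rfl).symm
  rw [h]
  rfl

theorem C₀_apply (i e : Fin 3) : C₀ i (i + e) = if e = 1 then 1 else 0 := by
  fin_cases i <;> fin_cases e <;> simp [C₀]

theorem norm_coin_le {φ : ℝ} (hC : maxNorm ((C : Matrix (Fin 3) (Fin 3) ℂ) - C₀) ≤ φ)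
    (i : Fin 3) {e : Fin 3} (he : e ≠ 1) : ‖(C : Matrix (Fin 3) (Fin 3) ℂ) i (i + e)‖ ≤ φ := by
  have h := (Finset.sup'_le_iff _ _).1 hC (i, i + e) (Finset.mem_univ _)
  simpa [C₀_apply, he] using h

/-- By `C₀_apply`, only `source 1` is active for `C₀`, so this is the full localization of the
unperturbed walk. -/
theorem source_one_iterate_six (c : Site × Fin 3) : (source 1)^[6] c = c := by
  obtain ⟨x, i⟩ := c
  fin_cases i <;> cases x <;> simp [source, shiftInv]

/-- The phase at `c` thus enters the product around the cycle exactly once, which makes the cycle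
factor affine in `e^{iω_c}`. -/
theorem source_one_iterate_ne (c : Site × Fin 3) {m : ℕ} (hm : 0 < m) (hm6 : m < 6) :
    (source 1)^[m] c ≠ c := by
  obtain ⟨x, i⟩ := c
  interval_cases m <;> fin_cases i <;> cases x <;> simp [source, shiftInv]

/-- The amplitude of the transition along the unperturbed cycle, at `c`. -/
def hop (θ : Site × Fin 3 → ℝ) (C : Matrix.unitaryGroup (Fin 3) ℂ) (z : ℂ)
    (c : Site × Fin 3) : ℂ :=
  z * (phase (θ c) * (C : Matrix (Fin 3) (Fin 3) ℂ) c.2 (c.2 + 1))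

/-- The amplitude of the unperturbed cycle through `c`, without the phase at `c`. -/
def cycleCoeff (θ : Site × Fin 3 → ℝ) (C : Matrix.unitaryGroup (Fin 3) ℂ) (z : ℂ)
    (c : Site × Fin 3) : ℂ :=
  z * (C : Matrix (Fin 3) (Fin 3) ℂ) c.2 (c.2 + 1) *
    ∏ m ∈ Finset.range 5, hop θ C z ((source 1)^[m + 1] c)

theorem norm_hop_le {z : ℂ} (hz : ‖z‖ < 1) (c : Site × Fin 3) : ‖hop θ C z c‖ ≤ 1 := by
  rw [hop, norm_mul, norm_mul, norm_phase, one_mul]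
  exact mul_le_one₀ hz.le (norm_nonneg _) (entry_norm_bound_of_unitary C.2 _ _)

theorem norm_cycleCoeff_le {z : ℂ} (hz : ‖z‖ < 1) (c : Site × Fin 3) :
    ‖cycleCoeff θ C z c‖ ≤ 1 := by
  rw [cycleCoeff, norm_mul, norm_mul, norm_prod]
  exact mul_le_one₀ (mul_le_one₀ hz.le (norm_nonneg _) (entry_norm_bound_of_unitary C.2 _ _))
    (by positivity) (Finset.prod_le_one (fun _ _ => norm_nonneg _) fun _ _ => norm_hop_le hz _)

theorem cycleCoeff_update (z : ℂ) (c : Site × Fin 3) (t : ℝ) :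
    cycleCoeff (Function.update θ c t) C z c = cycleCoeff θ C z c := by
  unfold cycleCoeff
  congr 1
  refine Finset.prod_congr rfl fun m hm => ?_
  rw [Finset.mem_range] at hm
  rw [hop, hop, Function.update_of_ne (source_one_iterate_ne c (by omega) (by omega))]

theorem continuous_cycleCoeff (z : ℂ) (c : Site × Fin 3) :
    Continuous fun θ : Site × Fin 3 → ℝ => cycleCoeff θ C z c := by
  unfold cycleCoeff hop
  refine continuous_const.mul (continuous_finsetProd _ fun m _ => ?_)
  exact continuous_const.mul ((continuous_phase.comp (continuous_apply _)).mul continuous_const)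

/-- The resolvent equation, solved around an unperturbed cycle. -/
theorem norm_one_sub_cycle_mul_green_le {φ : ℝ}
    (hC : maxNorm ((C : Matrix (Fin 3) (Fin 3) ℂ) - C₀) ≤ φ) {z : ℂ} (hz : ‖z‖ < 1)
    {c b : Site × Fin 3} (hcb : ∀ m < 6, (source 1)^[m] c ≠ b) :
    ‖(1 - phase (θ c) * cycleCoeff θ C z c) * green (walkOp θ C) z c b‖ ≤
      ∑ m ∈ Finset.range 6, (φ * ‖green (walkOp θ C) z (source 0 ((source 1)^[m] c)) b‖ +
        φ * ‖green (walkOp θ C) z (source 2 ((source 1)^[m] c)) b‖) := by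
  set G := fun c => green (walkOp θ C) z c b with hG
  -- The defect of the unperturbed recursion: only the two small coin entries contribute to it away
  -- from `b`.
  set ε : Site × Fin 3 → ℂ := fun c => G c - hop θ C z c * G (source 1 c) with hε
  have hεle : ∀ c, c ≠ b → ‖ε c‖ ≤ φ * ‖G (source 0 c)‖ + φ * ‖G (source 2 c)‖ := fun c hc => by
    have h := green_walkOp_eq (θ := θ) (C := C) hz c b
    rw [if_neg hc, zero_add, Fin.sum_univ_three] at h
    have e : ε c = z * phase (θ c) * ((C : Matrix (Fin 3) (Fin 3) ℂ) c.2 (c.2 + 0) * G (source 0 c) +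
        (C : Matrix (Fin 3) (Fin 3) ℂ) c.2 (c.2 + 2) * G (source 2 c)) := by
      simp only [hε, hop, hG]
      rw [h]
      ring
    rw [e, norm_mul, norm_mul, norm_phase, mul_one]
    refine (mul_le_of_le_one_left (norm_nonneg _) hz.le).trans ((norm_add_le _ _).trans ?_)
    rw [norm_mul, norm_mul]
    gcongr
    · exact norm_coin_le hC _ (by decide)
    · exact norm_coin_le hC _ (by decide)
  have hsum : ∀ k ≤ 6, ‖G c - (∏ m ∈ Finset.range k, hop θ C z ((source 1)^[m] c)) *
      G ((source 1)^[k] c)‖ ≤ ∑ m ∈ Finset.range k, (φ * ‖G (source 0 ((source 1)^[m] c))‖ +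
        φ * ‖G (source 2 ((source 1)^[m] c))‖) := by
    intro k
    induction k with
    | zero => intro _; simp
    | succ k ih =>
      intro hk
      rw [Finset.sum_range_succ, Finset.prod_range_succ, Function.iterate_succ_apply']
      set p := ∏ m ∈ Finset.range k, hop θ C z ((source 1)^[m] c) with hp
      have hp1 : ‖p‖ ≤ 1 := by
        rw [hp, norm_prod]
        exact Finset.prod_le_one (fun _ _ => norm_nonneg _) fun _ _ => norm_hop_le hz _
      have e : G c - p * hop θ C z ((source 1)^[k] c) * G (source 1 ((source 1)^[k] c)) =
          (G c - p * G ((source 1)^[k] c)) + p * ε ((source 1)^[k] c) := by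
        simp only [hε]; ring
      rw [e]
      refine (norm_add_le _ _).trans (add_le_add (ih (by omega)) ?_)
      rw [norm_mul]
      exact (mul_le_of_le_one_left (norm_nonneg _) hp1).trans (hεle _ (hcb k (by omega)))
  -- After six steps the recursion is back at `c`, so the accumulated product multiplies `G c`
  -- itself and moves to the left-hand side.
  have h6 := hsum 6 le_rfl
  rw [source_one_iterate_six, Finset.prod_range_succ'] at h6
  refine (le_of_eq ?_).trans h6
  congr 1
  simp only [hG, cycleCoeff, hop, Function.iterate_zero, id_eq]
  ring

theorem continuous_walkOp_pow_apply (b : Site × Fin 3) (n : ℕ) :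
    ∀ c, Continuous fun θ : Site × Fin 3 → ℝ => ((walkOp θ C ^ n) (basisVec b) : H) c := by
  induction n with
  | zero => intro c; simpa using continuous_const
  | succ n ih =>
    rintro ⟨x, i⟩
    simp_rw [pow_succ', mul_apply_eq_comp, walkOp_apply]
    exact (continuous_phase.comp (continuous_apply _)).mul
      (continuous_finsetSum _ fun j _ => continuous_const.mul (ih _))

theorem norm_walkOp_pow_apply_le (a b : Site × Fin 3) (n : ℕ) :
    ‖((walkOp θ C ^ n) (basisVec b) : H) a‖ ≤ 1 := by
  refine (norm_apply_le _ _).trans ?_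
  induction n with
  | zero => simp [norm_basisVec]
  | succ n ih =>
    rw [pow_succ', mul_apply_eq_comp, walkOp_eq_walk, LinearIsometryEquiv.norm_map]
    exact ih

theorem hasSum_green_walkOp {z : ℂ} (hz : ‖z‖ < 1) (a b : Site × Fin 3) :
    HasSum (fun n => z ^ n * ((walkOp θ C ^ n) (basisVec b) : H) a)
      (green (walkOp θ C) z a b) := by
  have h := (summable_geometric_of_norm_lt_one
    (norm_smul_lt_one (norm_walkOp_le (θ := θ) (C := C)) hz)).hasSum
  have h1 := h.mapL (ContinuousLinearMap.apply ℂ H (basisVec b))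
  have h2 := h1.mapL (innerSL ℂ (basisVec a))
  simp only [ContinuousLinearMap.apply_apply, innerSL_apply_apply, inner_basisVec_left] at h2
  rw [green, resolvent]
  refine h2.congr_fun fun n => ?_
  rw [smul_pow, smul_apply, L2.smul_apply]

theorem continuous_green_walkOp {r : ℝ} (hr : 0 ≤ r) (hr1 : r < 1) (a b : Site × Fin 3) :
    Continuous fun p : ℝ × (Site × Fin 3 → ℝ) =>
      green (walkOp p.2 C) (r * phase p.1) a b := by
  have hz : ∀ t, ‖(r : ℂ) * phase t‖ = r := fun t => by simp [abs_of_nonneg hr]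
  have e : ∀ p : ℝ × (Site × Fin 3 → ℝ), green (walkOp p.2 C) (r * phase p.1) a b =
      ∑' n, (r * phase p.1) ^ n * ((walkOp p.2 C ^ n) (basisVec b) : H) a := fun p =>
    (hasSum_green_walkOp (by rw [hz]; exact hr1) a b).tsum_eq.symm
  simp_rw [e]
  refine continuous_tsum (u := fun n => r ^ n) (fun n => ?_)
    (summable_geometric_of_lt_one hr hr1) fun n p => ?_
  · exact ((continuous_const.mul (continuous_phase.comp continuous_fst)).pow n).mul
      ((continuous_walkOp_pow_apply b n a).comp continuous_snd)
  · rw [norm_mul, norm_pow, hz]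
    exact mul_le_of_le_one_right (by positivity) (norm_walkOp_pow_apply_le a b n)

theorem continuous_green_walkOp' {z : ℂ} (hz : ‖z‖ < 1) (a b : Site × Fin 3) :
    Continuous fun θ : Site × Fin 3 → ℝ => green (walkOp θ C) z a b := by
  have e : ∀ θ : Site × Fin 3 → ℝ, green (walkOp θ C) z a b =
      ∑' n, z ^ n * ((walkOp θ C ^ n) (basisVec b) : H) a := fun p =>
    (hasSum_green_walkOp hz a b).tsum_eq.symm
  simp_rw [e]
  refine continuous_tsum (u := fun n => ‖z‖ ^ n)
    (fun n => continuous_const.mul (continuous_walkOp_pow_apply b n a))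
    (summable_geometric_of_lt_one (norm_nonneg _) hz) fun n p => ?_
  rw [norm_mul, norm_pow]
  exact mul_le_of_le_one_right (by positivity) (norm_walkOp_pow_apply_le a b n)

end Walk

/-! ### Lattice distance and summability of exponential weights -/

section Distance

/-- The coordinates of a site. -/
def coords : Site → Bool × ℤ × ℤ
  | .A j k => (false, j, k)
  | .B j k => (true, j, k)

theorem coords_injective : Function.Injective coords := by
  rintro (⟨j, k⟩ | ⟨j, k⟩) (⟨j', k'⟩ | ⟨j', k'⟩) h <;> simp_all [coords]

instance : Countable Site := coords_injective.countable

theorem latticeDist_triangle (x y w : Site) :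
    latticeDist x w ≤ latticeDist x y + latticeDist y w :=
  latticeGraph_connected.dist_triangle

theorem latticeDist_comm (x y : Site) : latticeDist x y = latticeDist y x :=
  SimpleGraph.dist_comm

theorem latticeDist_source_le (e : Fin 3) (c : Site × Fin 3) :
    latticeDist c.1 (source e c).1 ≤ 1 := by
  rw [latticeDist_comm]
  have h : latticeGraph.Adj (source e c).1 c.1 := ⟨c.2, shift_shiftInv c.2 c.1⟩
  exact (SimpleGraph.dist_eq_one_iff_adj.2 h).le

theorem latticeDist_source_iterate_le (c : Site × Fin 3) (m : ℕ) :
    latticeDist c.1 ((source 1)^[m] c).1 ≤ m := by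
  induction m with
  | zero => simp [latticeDist]
  | succ m ih =>
    rw [Function.iterate_succ_apply']
    exact (latticeDist_triangle _ _ _).trans (add_le_add ih (latticeDist_source_le _ _))

theorem coords_sub_le_latticeDist (x y : Site) :
    |(coords x).2.1 - (coords y).2.1| ≤ latticeDist x y ∧
      |(coords x).2.2 - (coords y).2.2| ≤ latticeDist x y := by
  obtain ⟨p, hp⟩ := latticeGraph_connected.exists_walk_length_eq_dist x y
  rw [latticeDist, ← hp]
  clear hp
  induction p with
  | nil => simp
  | @cons u v w h p ih =>
    have h1 : |(coords u).2.1 - (coords v).2.1| ≤ 1 ∧ |(coords u).2.2 - (coords v).2.2| ≤ 1 := by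
      obtain ⟨i, rfl⟩ := h
      fin_cases i <;> cases u <;> simp [shift, coords]
    rw [SimpleGraph.Walk.length_cons]
    push_cast
    constructor
    · have := abs_sub_le (coords u).2.1 (coords v).2.1 (coords w).2.1
      linarith [h1.1, ih.1]
    · have := abs_sub_le (coords u).2.2 (coords v).2.2 (coords w).2.2
      linarith [h1.2, ih.2]

theorem tsum_int_exp_ne_top :
    ∑' j : ℤ, ENNReal.ofReal (Real.exp (-(|j| : ℤ) / 8)) ≠ ∞ := by
  have h : Summable fun j : ℤ => Real.exp (-((|j| : ℤ) : ℝ) / 8) := by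
    have h1 : Summable fun n : ℕ => Real.exp (-(n : ℝ) / 8) := by
      have := Real.summable_exp_nat_mul_iff.2 (show (-(1 / 8) : ℝ) < 0 by norm_num)
      refine this.congr fun n => ?_
      congr 1; ring
    refine Summable.of_nat_of_neg ?_ ?_
    · simpa using h1
    · simpa using h1
  exact h.tsum_ofReal_ne_top

theorem tsum_exp_latticeDist_le (x : Site) :
    ∑' c : Site × Fin 3, ENNReal.ofReal (Real.exp (-(latticeDist x c.1 : ℝ) / 4)) ≤
      6 * (∑' j : ℤ, ENNReal.ofReal (Real.exp (-(|j| : ℤ) / 8))) ^ 2 := by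
  set f : ℤ → ℝ≥0∞ := fun j => ENNReal.ofReal (Real.exp (-((|j| : ℤ) : ℝ) / 8)) with hf
  set F : (Bool × Fin 3) × ℤ × ℤ → ℝ≥0∞ :=
    fun p => f ((coords x).2.1 - p.2.1) * f ((coords x).2.2 - p.2.2) with hF
  let ψ : Site × Fin 3 → (Bool × Fin 3) × ℤ × ℤ := fun c => (((coords c.1).1, c.2), (coords c.1).2)
  have hψ : Function.Injective ψ := by
    rintro ⟨y, i⟩ ⟨y', i'⟩ h
    simp only [ψ, Prod.mk.injEq] at h
    rw [coords_injective (Prod.ext h.1.1 h.2), h.1.2]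
  have h1 : ∀ c : Site × Fin 3,
      ENNReal.ofReal (Real.exp (-(latticeDist x c.1 : ℝ) / 4)) ≤ F (ψ c) := fun c => by
    simp only [hF, hf, ψ]
    rw [← ENNReal.ofReal_mul (Real.exp_pos _).le, ← Real.exp_add]
    refine ENNReal.ofReal_le_ofReal (Real.exp_le_exp.2 ?_)
    -- Half of the rate `1/4` is spent on each coordinate, so the sum factorizes into two sums over
    -- `ℤ`; the factor `6` counts two sublattices and three coin states.
    obtain ⟨h2, h3⟩ := coords_sub_le_latticeDist x c.1
    have h2' : ((|(coords x).2.1 - (coords c.1).2.1| : ℤ) : ℝ) ≤ latticeDist x c.1 := by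
      exact_mod_cast h2
    have h3' : ((|(coords x).2.2 - (coords c.1).2.2| : ℤ) : ℝ) ≤ latticeDist x c.1 := by
      exact_mod_cast h3
    linarith
  refine (ENNReal.tsum_le_tsum h1).trans ((ENNReal.tsum_comp_le_tsum_of_injective hψ F).trans ?_)
  have h4 : ∀ j₀ : ℤ, ∑' j, f (j₀ - j) = ∑' j, f j := fun j₀ => (Equiv.subLeft j₀).tsum_eq f
  have h5 : ∀ p : Bool × Fin 3, ∑' q : ℤ × ℤ, F (p, q) = (∑' j, f j) ^ 2 := fun p => by
    simp only [hF]
    rw [ENNReal.tsum_prod']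
    simp_rw [ENNReal.tsum_mul_left, ENNReal.tsum_mul_right, h4, sq]
  rw [ENNReal.tsum_prod']
  simp_rw [h5]
  rw [tsum_fintype, Finset.sum_const, Finset.card_univ]
  simp

end Distance

/-! ### Fractional moments: a priori bound and exponential decay -/

section Moments

variable {C : Matrix.unitaryGroup (Fin 3) ℂ}

theorem measurable_green_rpow {z : ℂ} (hz : ‖z‖ < 1) (a b : Site × Fin 3) (s : ℝ) :
    Measurable fun θ : Site × Fin 3 → ℝ => ‖green (walkOp θ C) z a b‖ₑ ^ s :=
  (continuous_green_walkOp' hz a b).measurable.enorm.pow_const s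

theorem measurable_green_comp {Ω : Type*} [MeasurableSpace Ω] {ω : Site × Fin 3 → Ω → ℝ}
    (hω : ∀ a, Measurable (ω a)) {z : ℂ} (hz : ‖z‖ < 1) (a b : Site × Fin 3) (s : ℝ) :
    Measurable fun w => ‖green (walkOp (fun a => ω a w) C) z a b‖ₑ ^ s :=
  (measurable_green_rpow hz a b s).comp (measurable_pi_lambda _ hω)

theorem measurable_enorm_green_comp {Ω : Type*} [MeasurableSpace Ω] {ω : Site × Fin 3 → Ω → ℝ}
    (hω : ∀ a, Measurable (ω a)) {z : ℂ} (hz : ‖z‖ < 1) (a b : Site × Fin 3) :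
    Measurable fun w => ‖green (walkOp (fun a => ω a w) C) z a b‖ₑ :=
  (continuous_green_walkOp' hz a b).measurable.enorm.comp (measurable_pi_lambda _ hω)

/-- The dependence of the walk on the phase at `a` is a factor of the row `a`. -/
theorem exists_walkOp_update (θ : Site × Fin 3 → ℝ) (C : Matrix.unitaryGroup (Fin 3) ℂ)
    (a : Site × Fin 3) : ∃ T : L2 (Site × Fin 3) →L[ℂ] L2 (Site × Fin 3), ‖T‖ ≤ 1 ∧
      (∀ x y, inner ℂ (ContinuousLinearMap.adjoint T x) (ContinuousLinearMap.adjoint T y) =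
        inner ℂ x y) ∧
      ∀ t, walkOp (Function.update θ a t) C = scaleRow a (phase t) T :=
  ⟨_, norm_walkOp_le, inner_adjoint_walkOp, walkOp_update a⟩

/-- The fractional moments of the resolvent. -/
def fracMoment {Ω : Type*} [MeasurableSpace Ω] (P : Measure Ω) (ω : Site × Fin 3 → Ω → ℝ)
    (C : Matrix.unitaryGroup (Fin 3) ℂ) (z : ℂ) (a b : Site × Fin 3) : ℝ≥0∞ :=
  ∫⁻ w, ‖green (walkOp (fun a => ω a w) C) z a b‖ₑ ^ (1 / 2 : ℝ) ∂P

theorem lintegral_green_sq_le {Ω : Type*} [MeasurableSpace Ω] {P : Measure Ω}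
    {ω : Site × Fin 3 → Ω → ℝ} (hω : ∀ a, Measurable (ω a))
    (hlaw : P.map (fun w a => ω a w) = Measure.infinitePi fun _ => phaseMeasure)
    {z : ℂ} (hz : ‖z‖ < 1) (a b : Site × Fin 3) :
    ENNReal.ofReal (1 - ‖z‖ ^ 2) *
        ∫⁻ w, ‖green (walkOp (fun a => ω a w) C) z a b‖ₑ ^ (2 : ℝ) ∂P ≤
      2 * fracMoment P ω C z a b := by
  rw [fracMoment, lintegral_resample hω hlaw a (measurable_green_rpow hz a b 2),
    lintegral_resample hω hlaw a (measurable_green_rpow hz a b (1 / 2)),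
    ← lintegral_const_mul' _ _ ENNReal.ofReal_ne_top, ← lintegral_const_mul' _ _ (by simp)]
  refine lintegral_mono fun w => ?_
  obtain ⟨T, hT, hT', hu⟩ := exists_walkOp_update (fun a => ω a w) C a
  simp_rw [hu, ENNReal.rpow_ofNat]
  exact lintegral_green_scaleRow_sq_le hT hT' hz a b

variable {Ω : Type*} [MeasurableSpace Ω] {P : Measure Ω}
  {ω : Site × Fin 3 → Ω → ℝ}

theorem fracMoment_le [IsProbabilityMeasure P] (hω : ∀ a, Measurable (ω a))
    (hlaw : P.map (fun w a => ω a w) = Measure.infinitePi fun _ => phaseMeasure)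
    {K : ℝ≥0∞} (hK1 : 1 ≤ K) (hK : ∀ ρ : ℂ,
      ∫⁻ t, ‖1 - phase t * ρ‖ₑ ^ (-(1 / 2) : ℝ) ∂phaseMeasure ≤ K)
    {z : ℂ} (hz : ‖z‖ < 1) (a b : Site × Fin 3) : fracMoment P ω C z a b ≤ K * K := by
  have hm := measurable_green_rpow (C := C) hz a b (1 / 2)
  rw [fracMoment, lintegral_resample hω hlaw b hm]
  by_cases hab : a = b
  · subst hab
    rw [← mul_one (K * K), ← measure_univ (μ := P), ← lintegral_const]
    refine lintegral_mono fun w => ?_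
    obtain ⟨T, hT, -, hu⟩ := exists_walkOp_update (fun a => ω a w) C a
    simp_rw [hu]
    refine (lintegral_green_scaleRow_le hK hT hz a a).trans ?_
    rw [green_scaleRow_zero hT hz, if_pos rfl]
    simpa using le_mul_of_one_le_right' hK1
  · have hm2 : Measurable fun θ : Site × Fin 3 → ℝ =>
        ∫⁻ t, ‖green (walkOp (Function.update θ b t) C) z a b‖ₑ ^ (1 / 2 : ℝ) ∂phaseMeasure :=
      (hm.comp (measurable_update_prod b)).lintegral_prod_right'
    rw [lintegral_resample hω hlaw a hm2, ← mul_one (K * K), ← measure_univ (μ := P),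
      ← lintegral_const]
    refine lintegral_mono fun w => ?_
    have h : ∀ s t : ℝ, walkOp (Function.update (Function.update (fun a => ω a w) a s) b t) C =
        scaleRow b (phase t) (scaleRow a (phase s)
          (walkOp (Function.update (Function.update (fun a => ω a w) b 0) a 0) C)) := fun s t => by
      rw [walkOp_update b t, Function.update_comm hab, walkOp_update a s]
    simp_rw [h]
    exact lintegral_green_scaleRow_two_le hK norm_walkOp_le hz hab

theorem rpow_half_sum_le {α : Type*} (s : Finset α) (f : α → ℝ≥0∞) :
    (∑ m ∈ s, f m) ^ (1 / 2 : ℝ) ≤ ∑ m ∈ s, f m ^ (1 / 2 : ℝ) :=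
  Finset.le_sum_of_subadditive (fun x : ℝ≥0∞ => x ^ (1 / 2 : ℝ)) (by simp)
    (fun x y => ENNReal.rpow_add_le_add_rpow x y (by norm_num) (by norm_num)) s f

/-- Resampling the phase at `c` leaves `cycleCoeff` fixed, so the one-phase decoupling applies with
`ζ = cycleCoeff`. -/
theorem fracMoment_le_decoupled (hω : ∀ a, Measurable (ω a))
    (hlaw : P.map (fun w a => ω a w) = Measure.infinitePi fun _ => phaseMeasure)
    {K : ℝ≥0∞} (hKtop : K ≠ ∞) (hK : ∀ ρ : ℂ,
      ∫⁻ t, ‖1 - phase t * ρ‖ₑ ^ (-(1 / 2) : ℝ) ∂phaseMeasure ≤ K)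
    {z : ℂ} (hz : ‖z‖ < 1) (c b : Site × Fin 3) :
    fracMoment P ω C z c b ≤ 4 * K * ∫⁻ w,
      ‖(1 - phase (ω c w) * cycleCoeff (fun a => ω a w) C z c) *
        green (walkOp (fun a => ω a w) C) z c b‖ₑ ^ (1 / 2 : ℝ) ∂P := by
  set F : (Site × Fin 3 → ℝ) → ℝ≥0∞ := fun θ =>
    ‖(1 - phase (θ c) * cycleCoeff θ C z c) * green (walkOp θ C) z c b‖ₑ ^ (1 / 2 : ℝ) with hF
  have hFm : Measurable F := by
    have h1 : Continuous fun θ : Site × Fin 3 → ℝ =>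
        (1 - phase (θ c) * cycleCoeff θ C z c) * green (walkOp θ C) z c b :=
      (continuous_const.sub ((continuous_phase.comp (continuous_apply c)).mul
        (continuous_cycleCoeff z c))).mul (continuous_green_walkOp' hz c b)
    exact h1.measurable.enorm.pow_const _
  change _ ≤ 4 * K * ∫⁻ w, F (fun a => ω a w) ∂P
  rw [fracMoment, lintegral_resample hω hlaw c (measurable_green_rpow hz c b (1 / 2)),
    lintegral_resample hω hlaw c hFm,
    ← lintegral_const_mul' _ _ (ENNReal.mul_ne_top (by simp) hKtop)]
  refine lintegral_mono fun w => ?_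
  obtain ⟨T, hT, hT', hu⟩ := exists_walkOp_update (fun a => ω a w) C c
  simp only [hF, Function.update_self, cycleCoeff_update, hu]
  exact lintegral_green_scaleRow_decouple hK hT hT' hz c b (norm_cycleCoeff_le hz c)

theorem enorm_one_sub_cycle_mul_green_rpow_le {θ : Site × Fin 3 → ℝ} {φ : ℝ}
    (hC : maxNorm ((C : Matrix (Fin 3) (Fin 3) ℂ) - C₀) ≤ φ) (hφ : 0 ≤ φ)
    {z : ℂ} (hz : ‖z‖ < 1) {c b : Site × Fin 3} (hcb : ∀ m < 6, (source 1)^[m] c ≠ b) :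
    ‖(1 - phase (θ c) * cycleCoeff θ C z c) * green (walkOp θ C) z c b‖ₑ ^ (1 / 2 : ℝ) ≤
      ∑ m ∈ Finset.range 6, (ENNReal.ofReal φ ^ (1 / 2 : ℝ) *
        (‖green (walkOp θ C) z (source 0 ((source 1)^[m] c)) b‖ₑ ^ (1 / 2 : ℝ) +
          ‖green (walkOp θ C) z (source 2 ((source 1)^[m] c)) b‖ₑ ^ (1 / 2 : ℝ))) := by
  have h3 := ENNReal.ofReal_le_ofReal (norm_one_sub_cycle_mul_green_le (θ := θ) hC hz hcb)
  rw [ofReal_norm, ENNReal.ofReal_sum_of_nonneg (fun _ _ => by positivity)] at h3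
  refine (ENNReal.rpow_le_rpow h3 (by norm_num)).trans ((rpow_half_sum_le _ _).trans ?_)
  refine Finset.sum_le_sum fun m _ => ?_
  rw [← mul_add, ENNReal.ofReal_mul hφ, ENNReal.mul_rpow_of_nonneg _ _ (by norm_num),
    ENNReal.ofReal_add (norm_nonneg _) (norm_nonneg _), ofReal_norm, ofReal_norm]
  exact mul_le_mul_right (ENNReal.rpow_add_le_add_rpow _ _ (by norm_num) (by norm_num)) _

theorem lintegral_sum_const_mul_add {α : Type*} (s : Finset α) (p : ℝ≥0∞) {f g : α → Ω → ℝ≥0∞}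
    (hf : ∀ m, Measurable (f m)) (hg : ∀ m, Measurable (g m)) :
    ∫⁻ w, ∑ m ∈ s, p * (f m w + g m w) ∂P =
      ∑ m ∈ s, p * (∫⁻ w, f m w ∂P + ∫⁻ w, g m w ∂P) := by
  rw [lintegral_finsetSum _ (by fun_prop)]
  refine Finset.sum_congr rfl fun m _ => ?_
  rw [lintegral_const_mul p (by fun_prop), lintegral_add_left (hf m)]

theorem fracMoment_step (hω : ∀ a, Measurable (ω a))
    (hlaw : P.map (fun w a => ω a w) = Measure.infinitePi fun _ => phaseMeasure)
    {K : ℝ≥0∞} (hKtop : K ≠ ∞) (hK : ∀ ρ : ℂ,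
      ∫⁻ t, ‖1 - phase t * ρ‖ₑ ^ (-(1 / 2) : ℝ) ∂phaseMeasure ≤ K)
    {φ : ℝ} (hC : maxNorm ((C : Matrix (Fin 3) (Fin 3) ℂ) - C₀) ≤ φ) (hφ : 0 ≤ φ)
    {z : ℂ} (hz : ‖z‖ < 1) {c b : Site × Fin 3} (hcb : ∀ m < 6, (source 1)^[m] c ≠ b) :
    fracMoment P ω C z c b ≤ 4 * K * ∑ m ∈ Finset.range 6, (ENNReal.ofReal φ ^ (1 / 2 : ℝ) *
      (fracMoment P ω C z (source 0 ((source 1)^[m] c)) b +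
        fracMoment P ω C z (source 2 ((source 1)^[m] c)) b)) := by
  refine (fracMoment_le_decoupled hω hlaw hKtop hK hz c b).trans (mul_le_mul_right ?_ _)
  refine (lintegral_mono fun w =>
    enorm_one_sub_cycle_mul_green_rpow_le (θ := fun a => ω a w) hC hφ hz hcb).trans_eq ?_
  have hm := fun a => measurable_green_comp (C := C) hω hz a b (1 / 2)
  generalize ENNReal.ofReal φ ^ (1 / 2 : ℝ) = p
  exact lintegral_sum_const_mul_add _ p (fun m => hm (source 0 ((source 1)^[m] c)))
    fun m => hm (source 2 ((source 1)^[m] c))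

/-- Exponential decay of the fractional moments. -/
theorem fracMoment_le_pow [IsProbabilityMeasure P] (hω : ∀ a, Measurable (ω a))
    (hlaw : P.map (fun w a => ω a w) = Measure.infinitePi fun _ => phaseMeasure)
    {K : ℝ≥0∞} (hKtop : K ≠ ∞) (hK1 : 1 ≤ K) (hK : ∀ ρ : ℂ,
      ∫⁻ t, ‖1 - phase t * ρ‖ₑ ^ (-(1 / 2) : ℝ) ∂phaseMeasure ≤ K)
    {φ : ℝ} (hC : maxNorm ((C : Matrix (Fin 3) (Fin 3) ℂ) - C₀) ≤ φ) (hφ : 0 ≤ φ)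
    {q : ℝ≥0∞} (hq : 48 * K * ENNReal.ofReal φ ^ (1 / 2 : ℝ) ≤ q)
    {z : ℂ} (hz : ‖z‖ < 1) (b : Site × Fin 3) (n : ℕ) :
    ∀ a : Site × Fin 3, 7 * n ≤ latticeDist a.1 b.1 →
      fracMoment P ω C z a b ≤ q ^ n * (K * K) := by
  induction n with
  | zero => intro a _; simpa using fracMoment_le hω hlaw hK1 hK hz a b
  | succ n ih =>
    intro a hab
    -- One iteration moves by at most five steps along the cycle and one step off it. A loss of `7`
    -- in distance therefore suffices, and also keeps `b` off the cycle.
    have hd : ∀ m, 7 * (n + 1) ≤ m + latticeDist ((source 1)^[m] a).1 b.1 := fun m =>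
      hab.trans ((latticeDist_triangle _ _ _).trans
        (Nat.add_le_add_right (latticeDist_source_iterate_le a m) _))
    have hne : ∀ m < 6, (source 1)^[m] a ≠ b := fun m hm h => by
      have := hd m
      rw [h, latticeDist, SimpleGraph.dist_self] at this
      omega
    have hs : ∀ m < 6, ∀ e, fracMoment P ω C z (source e ((source 1)^[m] a)) b ≤
        q ^ n * (K * K) := fun m hm e => by
      refine ih _ ?_
      have h1 := hd m
      have h2 := latticeDist_triangle ((source 1)^[m] a).1 (source e ((source 1)^[m] a)).1 b.1
      have h3 := latticeDist_source_le e ((source 1)^[m] a)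
      omega
    refine (fracMoment_step hω hlaw hKtop hK hC hφ hz hne).trans ?_
    have h4 : ∑ m ∈ Finset.range 6, (ENNReal.ofReal φ ^ (1 / 2 : ℝ) *
        (fracMoment P ω C z (source 0 ((source 1)^[m] a)) b +
          fracMoment P ω C z (source 2 ((source 1)^[m] a)) b)) ≤
        ∑ m ∈ Finset.range 6, (ENNReal.ofReal φ ^ (1 / 2 : ℝ) *
          (q ^ n * (K * K) + q ^ n * (K * K))) := by
      refine Finset.sum_le_sum fun m hm => ?_
      rw [Finset.mem_range] at hm
      gcongr
      · exact hs m hm 0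
      · exact hs m hm 2
    refine (mul_le_mul_right h4 _).trans ?_
    rw [Finset.sum_const, Finset.card_range, nsmul_eq_mul, pow_succ']
    -- `48 = 4 · 6 · 2`: decoupling constant, cycle length, and two exits at each label.
    calc 4 * K * (((6 : ℕ) : ℝ≥0∞) * (ENNReal.ofReal φ ^ (1 / 2 : ℝ) *
          (q ^ n * (K * K) + q ^ n * (K * K))))
        = 48 * K * ENNReal.ofReal φ ^ (1 / 2 : ℝ) * (q ^ n * (K * K)) := by push_cast; ring
      _ ≤ q * q ^ n * (K * K) := by rw [mul_assoc q]; gcongr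

/-! ### Second moments and the eigenfunction correlator -/

/-- Decay of the weighted correlation of two rows of the resolvent. -/
theorem lintegral_green_mul_green_le (hω : ∀ a, Measurable (ω a))
    (hlaw : P.map (fun w a => ω a w) = Measure.infinitePi fun _ => phaseMeasure)
    {M : ℝ≥0∞} {z : ℂ} (hz : ‖z‖ < 1)
    (hM : ∀ a b : Site × Fin 3, fracMoment P ω C z a b ≤
      M * ENNReal.ofReal (Real.exp (-(latticeDist a.1 b.1 : ℝ)))) (a b c : Site × Fin 3) :
    ENNReal.ofReal (1 - ‖z‖ ^ 2) *
        ∫⁻ w, ‖green (walkOp (fun a => ω a w) C) z a c‖ₑ *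
          ‖green (walkOp (fun a => ω a w) C) z b c‖ₑ ∂P ≤
      2 * M * (ENNReal.ofReal (Real.exp (-(latticeDist a.1 b.1 : ℝ) / 4)) *
        ENNReal.ofReal (Real.exp (-(latticeDist a.1 c.1 : ℝ) / 4))) := by
  have hm := fun a => (measurable_enorm_green_comp (C := C) hω hz a c).aemeasurable (μ := P)
  have hcs := ENNReal.lintegral_mul_le_Lp_mul_Lq P Real.HolderConjugate.two_two (hm a) (hm b)
  set α := ENNReal.ofReal (1 - ‖z‖ ^ 2) with hα
  have hα2 : α = α ^ (1 / 2 : ℝ) * α ^ (1 / 2 : ℝ) := by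
    rw [← ENNReal.rpow_add_of_nonneg _ _ (by norm_num) (by norm_num)]; norm_num
  have hb : ∀ a, α ^ (1 / 2 : ℝ) *
      (∫⁻ w, ‖green (walkOp (fun a => ω a w) C) z a c‖ₑ ^ (2 : ℝ) ∂P) ^ (1 / 2 : ℝ) ≤
      (2 * M) ^ (1 / 2 : ℝ) * ENNReal.ofReal (Real.exp (-(latticeDist a.1 c.1 : ℝ) / 2)) := by
    intro a
    rw [← ENNReal.mul_rpow_of_nonneg _ _ (by norm_num)]
    have h1 := (lintegral_green_sq_le (C := C) hω hlaw hz a c).trans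
      (mul_le_mul_right (hM a c) 2)
    refine (ENNReal.rpow_le_rpow h1 (by norm_num)).trans_eq ?_
    rw [← mul_assoc, ENNReal.mul_rpow_of_nonneg _ _ (by norm_num),
      ENNReal.ofReal_rpow_of_pos (Real.exp_pos _), ← Real.exp_mul]
    congr 4
    ring
  calc α * ∫⁻ w, ‖green (walkOp (fun a => ω a w) C) z a c‖ₑ *
          ‖green (walkOp (fun a => ω a w) C) z b c‖ₑ ∂P
      ≤ α * ((∫⁻ w, ‖green (walkOp (fun a => ω a w) C) z a c‖ₑ ^ (2 : ℝ) ∂P) ^ (1 / 2 : ℝ) *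
          (∫⁻ w, ‖green (walkOp (fun a => ω a w) C) z b c‖ₑ ^ (2 : ℝ) ∂P) ^ (1 / 2 : ℝ)) :=
        mul_le_mul_right hcs α
    _ = (α ^ (1 / 2 : ℝ) *
          (∫⁻ w, ‖green (walkOp (fun a => ω a w) C) z a c‖ₑ ^ (2 : ℝ) ∂P) ^ (1 / 2 : ℝ)) *
        (α ^ (1 / 2 : ℝ) *
          (∫⁻ w, ‖green (walkOp (fun a => ω a w) C) z b c‖ₑ ^ (2 : ℝ) ∂P) ^ (1 / 2 : ℝ)) := by
        conv_lhs => rw [hα2]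
        ring
    _ ≤ _ := mul_le_mul' (hb a) (hb b)
    _ = (2 * M) ^ (1 / 2 : ℝ) * (2 * M) ^ (1 / 2 : ℝ) *
        (ENNReal.ofReal (Real.exp (-(latticeDist a.1 c.1 : ℝ) / 2)) *
          ENNReal.ofReal (Real.exp (-(latticeDist b.1 c.1 : ℝ) / 2))) := by ring
    _ ≤ _ := by
        rw [← ENNReal.rpow_add_of_nonneg _ _ (by norm_num) (by norm_num),
          ← ENNReal.ofReal_mul (Real.exp_pos _).le, ← Real.exp_add,
          ← ENNReal.ofReal_mul (Real.exp_pos _).le, ← Real.exp_add]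
        norm_num only [ENNReal.rpow_one]
        refine mul_le_mul_right (ENNReal.ofReal_le_ofReal (Real.exp_le_exp.2 ?_)) _
        -- Cauchy-Schwarz gives decay of rate `1/2` in both distances to `c`. A quarter yields decay
        -- between `a` and `b`, and a remaining quarter in the distance from `a` to `c` makes the
        -- sum over `c` converge.
        have h1 : (latticeDist a.1 b.1 : ℝ) ≤ latticeDist a.1 c.1 + latticeDist b.1 c.1 := by
          rw [latticeDist_comm b.1 c.1]
          exact_mod_cast latticeDist_triangle a.1 c.1 b.1
        have h2 : (0 : ℝ) ≤ latticeDist b.1 c.1 := by positivity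
        linarith

/-- An upper bound for the eigenfunction correlator, at radius `r`. -/
def correlator (C : Matrix.unitaryGroup (Fin 3) ℂ) (r : ℝ) (a b : Site × Fin 3)
    (θ : Site × Fin 3 → ℝ) : ℝ≥0∞ :=
  ∫⁻ t, ENNReal.ofReal (1 - r ^ 2) * ∑' c, ‖green (walkOp θ C) (r * phase t) a c‖ₑ *
    ‖green (walkOp θ C) (r * phase t) b c‖ₑ ∂phaseMeasure

theorem correlator_comm (r : ℝ) (a b : Site × Fin 3) (θ : Site × Fin 3 → ℝ) :
    correlator C r a b θ = correlator C r b a θ := by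
  simp_rw [correlator, mul_comm]

theorem norm_ofReal_mul_phase {r : ℝ} (hr : 0 ≤ r) (t : ℝ) : ‖(r : ℂ) * phase t‖ = r := by
  simp [abs_of_nonneg hr]

theorem measurable_correlator_integrand {r : ℝ} (hr : 0 ≤ r) (hr1 : r < 1) (a b : Site × Fin 3) :
    Measurable fun p : ℝ × (Site × Fin 3 → ℝ) => ENNReal.ofReal (1 - r ^ 2) *
      ∑' c, ‖green (walkOp p.2 C) (r * phase p.1) a c‖ₑ *
        ‖green (walkOp p.2 C) (r * phase p.1) b c‖ₑ :=
  (Measurable.tsum fun c =>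
    (continuous_green_walkOp hr hr1 a c).measurable.enorm.mul
      (continuous_green_walkOp hr hr1 b c).measurable.enorm).const_mul _

theorem measurable_correlator {r : ℝ} (hr : 0 ≤ r) (hr1 : r < 1) (a b : Site × Fin 3) :
    Measurable (correlator C r a b) :=
  (measurable_correlator_integrand hr hr1 a b).lintegral_prod_left'

/-- By Tonelli the expectation is taken at fixed `z = r e^{it}`, where the moment bounds hold
uniformly; the weight `1 - r²` is exactly `1 - ‖z‖²`. -/
theorem lintegral_correlator_le [IsProbabilityMeasure P] (hω : ∀ a, Measurable (ω a))
    (hlaw : P.map (fun w a => ω a w) = Measure.infinitePi fun _ => phaseMeasure)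
    {M : ℝ≥0∞} (hM : ∀ z : ℂ, ‖z‖ < 1 → ∀ a b : Site × Fin 3, fracMoment P ω C z a b ≤
      M * ENNReal.ofReal (Real.exp (-(latticeDist a.1 b.1 : ℝ))))
    {r : ℝ} (hr : 0 ≤ r) (hr1 : r < 1) (a b : Site × Fin 3) :
    ∫⁻ w, correlator C r a b (fun a => ω a w) ∂P ≤
      2 * M * (ENNReal.ofReal (Real.exp (-(latticeDist a.1 b.1 : ℝ) / 4)) *
        (6 * (∑' j : ℤ, ENNReal.ofReal (Real.exp (-(|j| : ℤ) / 8))) ^ 2)) := by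
  have hmω : Measurable fun w a => ω a w := measurable_pi_lambda _ hω
  have hmp := (measurable_correlator_integrand (C := C) hr hr1 a b).comp
    (measurable_snd.prodMk (hmω.comp measurable_fst) :
      Measurable fun p : Ω × ℝ => (p.2, fun a => ω a p.1))
  have hswap := lintegral_lintegral_swap (μ := P) (ν := phaseMeasure)
    (f := fun w t => ENNReal.ofReal (1 - r ^ 2) *
      ∑' c, ‖green (walkOp (fun a => ω a w) C) (r * phase t) a c‖ₑ *
        ‖green (walkOp (fun a => ω a w) C) (r * phase t) b c‖ₑ) hmp.aemeasurable
  simp_rw [correlator]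
  rw [hswap]
  set B := 2 * M * (ENNReal.ofReal (Real.exp (-(latticeDist a.1 b.1 : ℝ) / 4)) *
        (6 * (∑' j : ℤ, ENNReal.ofReal (Real.exp (-(|j| : ℤ) / 8))) ^ 2)) with hB
  rw [← mul_one B, ← measure_univ (μ := phaseMeasure), ← lintegral_const]
  refine lintegral_mono fun t => ?_
  have hz := norm_ofReal_mul_phase hr t
  have hz1 : ‖(r : ℂ) * phase t‖ < 1 := by rw [hz]; exact hr1
  have hm := fun a c => measurable_enorm_green_comp (C := C) hω hz1 a c
  have hp : ∀ c, AEMeasurable (fun w => ‖green (walkOp (fun a => ω a w) C) (r * phase t) a c‖ₑ *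
      ‖green (walkOp (fun a => ω a w) C) (r * phase t) b c‖ₑ) P := fun c =>
    ((hm a c).mul (hm b c)).aemeasurable
  rw [lintegral_const_mul' _ _ ENNReal.ofReal_ne_top, lintegral_tsum hp, ← ENNReal.tsum_mul_left]
  have h1 := fun c => lintegral_green_mul_green_le hω hlaw hz1 (hM _ hz1) a b c
  rw [hz] at h1
  refine (ENNReal.tsum_le_tsum h1).trans ?_
  rw [ENNReal.tsum_mul_left, ENNReal.tsum_mul_left, hB]
  gcongr
  exact tsum_exp_latticeDist_le a.1

end Moments

/-! ### From resolvents to all powers of the walk -/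

section Dynamics

variable {C : Matrix.unitaryGroup (Fin 3) ℂ} {θ : Site × Fin 3 → ℝ}

theorem integrable_phase_zpow_mul_tsum (a : ℕ → ℂ) (ha : Summable fun m => ‖a m‖) (n : ℤ) :
    Integrable (fun t => phase t ^ n * ∑' m, a m * phase t ^ m) phaseMeasure := by
  have hn : ∀ t m, ‖a m * phase t ^ m‖ = ‖a m‖ := fun t m => by simp
  refine Integrable.of_bound (C := ∑' m, ‖a m‖) (Continuous.aestronglyMeasurable ?_)
    (Filter.Eventually.of_forall fun t => ?_)
  · exact (continuous_phase.zpow₀ _ fun t => Or.inl (phase_ne_zero t)).mul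
      (continuous_tsum (fun m => continuous_const.mul (continuous_phase.pow m)) ha
        fun m t => (hn t m).le)
  · rw [norm_mul, norm_zpow, norm_phase, one_zpow, one_mul]
    refine (norm_tsum_le_tsum_norm ?_).trans_eq (tsum_congr (hn t))
    simpa only [hn] using ha

theorem summable_norm_pow_mul_walkOp {r : ℝ} (hr : 0 ≤ r) (hr1 : r < 1) (a b : Site × Fin 3) :
    Summable fun m : ℕ => ‖(r : ℂ) ^ m * ((walkOp θ C ^ m) (basisVec b) : H) a‖ := by
  refine Summable.of_nonneg_of_le (fun _ => norm_nonneg _) (fun m => ?_)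
    (summable_geometric_of_lt_one hr hr1)
  rw [norm_mul, norm_pow, Complex.norm_real, Real.norm_of_nonneg hr]
  exact mul_le_of_le_one_right (by positivity) (norm_walkOp_pow_apply_le a b m)

theorem green_ofReal_mul_phase {r : ℝ} (hr : 0 ≤ r) (hr1 : r < 1) (a b : Site × Fin 3) (t : ℝ) :
    green (walkOp θ C) (r * phase t) a b =
      ∑' m : ℕ, (r : ℂ) ^ m * ((walkOp θ C ^ m) (basisVec b) : H) a * phase t ^ m := by
  rw [← (hasSum_green_walkOp (by rw [norm_ofReal_mul_phase hr]; exact hr1) a b).tsum_eq]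
  exact tsum_congr fun m => by ring

theorem integral_phase_zpow_mul_green {r : ℝ} (hr : 0 ≤ r) (hr1 : r < 1) (a b : Site × Fin 3)
    (n : ℤ) : ∫ t, phase t ^ (-n) * green (walkOp θ C) (r * phase t) a b ∂phaseMeasure =
      if 0 ≤ n then (r : ℂ) ^ n.toNat * ((walkOp θ C ^ n.toNat) (basisVec b) : H) a else 0 := by
  rw [← integral_phase_zpow_mul_tsum _ (summable_norm_pow_mul_walkOp hr hr1 a b) n]
  simp_rw [green_ofReal_mul_phase hr hr1]

theorem integrable_phase_zpow_mul_green {r : ℝ} (hr : 0 ≤ r) (hr1 : r < 1) (a b : Site × Fin 3)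
    (n : ℤ) : Integrable (fun t => phase t ^ n * green (walkOp θ C) (r * phase t) a b)
      phaseMeasure := by
  simp_rw [green_ofReal_mul_phase hr hr1]
  exact integrable_phase_zpow_mul_tsum _ (summable_norm_pow_mul_walkOp hr hr1 a b) n

/-- The matrix elements of the powers of the walk are Fourier coefficients of a correlation of
rows of the resolvent. -/
theorem pow_mul_walkOp_pow_apply_eq {r : ℝ} (hr : 0 ≤ r) (hr1 : r < 1) (a b : Site × Fin 3)
    (n : ℕ) : (r : ℂ) ^ n * ((walkOp θ C ^ n) (basisVec b) : H) a =
      ∫ t, phase t ^ (-(n : ℤ)) * ((1 - r ^ 2 : ℂ) * inner ℂ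
        (greenRow (walkOp θ C) (r * phase t) a) (greenRow (walkOp θ C) (r * phase t) b))
        ∂phaseMeasure := by
  have e : ∀ t, phase t ^ (-(n : ℤ)) * ((1 - r ^ 2 : ℂ) * inner ℂ
        (greenRow (walkOp θ C) (r * phase t) a) (greenRow (walkOp θ C) (r * phase t) b)) =
      (phase t ^ (-(n : ℤ)) * green (walkOp θ C) (r * phase t) a b +
        starRingEnd ℂ (phase t ^ (n : ℤ) * green (walkOp θ C) (r * phase t) b a)) -
      phase t ^ (-(n : ℤ)) * if a = b then 1 else 0 := fun t => by
    have hz := norm_ofReal_mul_phase hr t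
    have h := inner_greenRow (norm_walkOp_le (θ := θ) (C := C)) inner_adjoint_walkOp
      (z := r * phase t) (by rw [hz]; exact hr1) a b
    rw [hz] at h
    have hc : starRingEnd ℂ (phase t) = (phase t)⁻¹ := by
      rw [Complex.inv_def, Complex.normSq_eq_norm_sq, norm_phase]; simp
    rw [h, map_mul, map_zpow₀, hc, inv_zpow, ← zpow_neg]
    ring
  have hi1 := integrable_phase_zpow_mul_green (θ := θ) (C := C) hr hr1 a b (-(n : ℤ))
  have hi2 := integrable_phase_zpow_mul_green (θ := θ) (C := C) hr hr1 b a (n : ℤ)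
  have hi2' : Integrable (fun t =>
      starRingEnd ℂ (phase t ^ (n : ℤ) * green (walkOp θ C) (r * phase t) b a)) phaseMeasure :=
    (Complex.conjCLE.toContinuousLinearMap.integrable_comp hi2)
  have hi3 : Integrable (fun t => phase t ^ (-(n : ℤ)) * if a = b then (1 : ℂ) else 0)
      phaseMeasure := by
    refine Integrable.mul_const ?_ _
    refine Integrable.of_bound (C := 1) ?_ (Filter.Eventually.of_forall fun t => by simp)
    exact (continuous_phase.zpow₀ _ fun t => Or.inl (phase_ne_zero t)).aestronglyMeasurable
  have hi12 : Integrable (fun t => phase t ^ (-(n : ℤ)) * green (walkOp θ C) (r * phase t) a b +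
      starRingEnd ℂ (phase t ^ (n : ℤ) * green (walkOp θ C) (r * phase t) b a)) phaseMeasure :=
    hi1.add hi2'
  rw [integral_congr_ae (Filter.Eventually.of_forall e), integral_sub hi12 hi3,
    integral_add hi1 hi2', integral_conj, integral_mul_const,
    integral_phase_zpow, integral_phase_zpow_mul_green hr hr1]
  have h2 := integral_phase_zpow_mul_green (θ := θ) (C := C) hr hr1 b a (-(n : ℤ))
  rw [neg_neg] at h2
  rw [h2]
  -- For `n = 0` both resolvent terms contribute the Kronecker delta and the third cancels one of
  -- them; for `n > 0` only the first term has a nonzero coefficient.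
  rcases Nat.eq_zero_or_pos n with rfl | hn
  · simp [basisVec_apply, eq_comm]
  · have h3 : ¬ (0 : ℤ) ≤ -(n : ℤ) := by omega
    have h4 : -(n : ℤ) ≠ 0 := by omega
    rw [if_neg h3, if_neg h4]
    simp

theorem pow_mul_walkOp_pow_le_correlator {r : ℝ} (hr : 0 ≤ r) (hr1 : r < 1)
    (a b : Site × Fin 3) (n : ℕ) :
    ENNReal.ofReal (r ^ n) * ‖((walkOp θ C ^ n) (basisVec b) : H) a‖ₑ ≤ correlator C r a b θ := by
  have hr2 : 0 ≤ 1 - r ^ 2 := by nlinarith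
  have h1 : ENNReal.ofReal (r ^ n) * ‖((walkOp θ C ^ n) (basisVec b) : H) a‖ₑ =
      ‖(r : ℂ) ^ n * ((walkOp θ C ^ n) (basisVec b) : H) a‖ₑ := by
    rw [enorm_mul, ← ofReal_norm ((r : ℂ) ^ n), norm_pow, Complex.norm_real, Real.norm_of_nonneg hr]
  rw [h1, pow_mul_walkOp_pow_apply_eq hr hr1 a b n]
  refine (enorm_integral_le_lintegral_enorm _).trans (lintegral_mono fun t => ?_)
  have e : ‖(1 - r ^ 2 : ℂ)‖ₑ = ENNReal.ofReal (1 - r ^ 2) := by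
    rw [← ofReal_norm, ← Real.norm_of_nonneg hr2, ← Complex.norm_real]; push_cast; rfl
  have e2 : ‖phase t ^ (-(n : ℤ))‖ₑ = 1 := by rw [← ofReal_norm]; simp
  rw [enorm_mul, enorm_mul, e, e2, one_mul]
  refine mul_le_mul_right ?_ _
  rw [← (hasSum_inner_greenRow (walkOp θ C) (r * phase t) a b).tsum_eq]
  refine enorm_tsum_le_tsum_enorm.trans_eq (tsum_congr fun c => ?_)
  rw [enorm_mul, RCLike.enorm_conj]

theorem walkOp_pow_eq (n : ℕ) (f : H) : (walkOp θ C ^ n) f = (walk θ C ^ n) f := by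
  induction n with
  | zero => simp
  | succ n ih =>
    rw [pow_succ', mul_apply_eq_comp, ih, walkOp_eq_walk, pow_succ']
    rfl

theorem pow_natAbs_mul_walk_zpow_le_correlator {r : ℝ} (hr : 0 ≤ r) (hr1 : r < 1)
    (a b : Site × Fin 3) (n : ℤ) :
    ENNReal.ofReal (r ^ n.natAbs) *
      ‖inner ℂ (basisVec a : H) ((walk θ C ^ n) (basisVec b))‖ₑ ≤ correlator C r a b θ := by
  obtain ⟨m, rfl | rfl⟩ := n.eq_nat_or_neg
  · rw [inner_basisVec_left, zpow_natCast, Int.natAbs_natCast, ← walkOp_pow_eq]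
    exact pow_mul_walkOp_pow_le_correlator hr hr1 a b m
  -- By unitarity a negative power is a conjugated positive power with `a` and `b` exchanged, and
  -- the correlator is symmetric.
  · have h : inner ℂ (basisVec a : H) ((walk θ C ^ (-(m : ℤ))) (basisVec b)) =
        starRingEnd ℂ (((walkOp θ C ^ m) (basisVec a) : H) b) := by
      rw [walkOp_pow_eq, ← inner_basisVec_left, inner_conj_symm,
        ← LinearIsometryEquiv.inner_map_map (walk θ C ^ m)]
      congr 1
      rw [zpow_neg, zpow_natCast]
      exact (walk θ C ^ m).apply_symm_apply _
    rw [h, RCLike.enorm_conj, Int.natAbs_neg, Int.natAbs_natCast, correlator_comm]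
    exact pow_mul_walkOp_pow_le_correlator hr hr1 b a m

/-- For each `n` the weight `r^|n|` tends to `1`, so the supremum lies below the lower limit of the
correlators as `r → 1`; Fatou's lemma then carries over the uniform bound. -/
theorem lintegral_iSup_walk_le {Ω : Type*} [MeasurableSpace Ω] {P : Measure Ω}
    {ω : Site × Fin 3 → Ω → ℝ} (hω : ∀ a, Measurable (ω a)) (a b : Site × Fin 3) {B : ℝ≥0∞}
    (hB : ∀ r : ℝ, 0 ≤ r → r < 1 → ∫⁻ w, correlator C r a b (fun a => ω a w) ∂P ≤ B) :
    ∫⁻ w, ⨆ n : ℤ, ‖inner ℂ (basisVec a : H)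
      ((walk (fun a => ω a w) C ^ n) (basisVec b))‖ₑ ∂P ≤ B := by
  obtain ⟨r, -, hr, hlim⟩ := exists_seq_strictMono_tendsto' (zero_lt_one (α := ℝ))
  have h1 : ∀ w, (⨆ n : ℤ, ‖inner ℂ (basisVec a : H)
      ((walk (fun a => ω a w) C ^ n) (basisVec b))‖ₑ) ≤
      Filter.liminf (fun k => correlator C (r k) a b (fun a => ω a w)) Filter.atTop := fun w => by
    refine iSup_le fun n => ?_
    set v := ‖inner ℂ (basisVec a : H) ((walk (fun a => ω a w) C ^ n) (basisVec b))‖ₑ with hv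
    have h2 : Filter.Tendsto (fun k => ENNReal.ofReal (r k ^ n.natAbs) * v) Filter.atTop
        (nhds v) := by
      have h3 := ENNReal.Tendsto.mul_const (b := v)
        ((ENNReal.continuous_ofReal.tendsto _).comp (hlim.pow n.natAbs)) (Or.inr enorm_ne_top)
      simpa using h3
    rw [← h2.liminf_eq]
    exact Filter.liminf_le_liminf (Filter.Eventually.of_forall fun k =>
      pow_natAbs_mul_walk_zpow_le_correlator (hr k).1.le (hr k).2 a b n)
  refine (lintegral_mono h1).trans ((lintegral_liminf_le fun k =>
    (measurable_correlator (hr k).1.le (hr k).2 a b).comp (measurable_pi_lambda _ hω)).trans ?_)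
  exact Filter.liminf_le_of_frequently_le'
    (Filter.Frequently.of_forall fun k => hB (r k) (hr k).1.le (hr k).2)

end Dynamics

/-! ### Choice of constants and law of the phases -/

section Constants

theorem fracMoment_le_exp {C : Matrix.unitaryGroup (Fin 3) ℂ} {Ω : Type*} [MeasurableSpace Ω]
    {P : Measure Ω} [IsProbabilityMeasure P] {ω : Site × Fin 3 → Ω → ℝ}
    (hω : ∀ a, Measurable (ω a))
    (hlaw : P.map (fun w a => ω a w) = Measure.infinitePi fun _ => phaseMeasure)
    {K : ℝ≥0∞} (hKtop : K ≠ ∞) (hK1 : 1 ≤ K) (hK : ∀ ρ : ℂ,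
      ∫⁻ t, ‖1 - phase t * ρ‖ₑ ^ (-(1 / 2) : ℝ) ∂phaseMeasure ≤ K)
    (hC : maxNorm ((C : Matrix (Fin 3) (Fin 3) ℂ) - C₀) ≤ (Real.exp (-7) / (48 * K.toReal)) ^ 2)
    {z : ℂ} (hz : ‖z‖ < 1) (a b : Site × Fin 3) :
    fracMoment P ω C z a b ≤ K * K * ENNReal.ofReal (Real.exp 7) *
      ENNReal.ofReal (Real.exp (-(latticeDist a.1 b.1 : ℝ))) := by
  have hKpos : 0 < K.toReal := ENNReal.toReal_pos (zero_lt_one.trans_le hK1).ne' hKtop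
  -- The size of `φ` is chosen so that the contraction factor is `e^{-7}`, that is, rate `1` per
  -- unit of distance.
  have hq : 48 * K * ENNReal.ofReal ((Real.exp (-7) / (48 * K.toReal)) ^ 2) ^ (1 / 2 : ℝ) ≤
      ENNReal.ofReal (Real.exp (-7)) := by
    rw [ENNReal.ofReal_rpow_of_nonneg (by positivity) (by norm_num), ← Real.sqrt_eq_rpow,
      Real.sqrt_sq (by positivity)]
    obtain ⟨κ, hκ⟩ : ∃ κ, κ = K.toReal := ⟨_, rfl⟩
    have hKκ : K = ENNReal.ofReal κ := by rw [hκ, ENNReal.ofReal_toReal hKtop]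
    rw [← hκ] at hKpos ⊢
    rw [hKκ, ← ENNReal.ofReal_ofNat 48, ← ENNReal.ofReal_mul (by norm_num),
      ← ENNReal.ofReal_mul (by positivity)]
    refine ENNReal.ofReal_le_ofReal (le_of_eq ?_)
    field_simp
  -- The integer part of the distance over `7` iterations are available; rounding down costs at most
  -- the factor `e^7`.
  have h := fracMoment_le_pow hω hlaw hKtop hK1 hK hC (by positivity) hq hz b
    (latticeDist a.1 b.1 / 7) a (by omega)
  refine h.trans ?_
  rw [mul_comm, mul_assoc (K * K)]
  refine mul_le_mul_right ?_ _
  rw [← ENNReal.ofReal_pow (Real.exp_pos _).le, ← ENNReal.ofReal_mul (Real.exp_pos _).le,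
    ← Real.exp_nat_mul, ← Real.exp_add]
  refine ENNReal.ofReal_le_ofReal (Real.exp_le_exp.2 ?_)
  have h1 : latticeDist a.1 b.1 ≤ 7 * (latticeDist a.1 b.1 / 7) + 7 := by omega
  have h2 : (latticeDist a.1 b.1 : ℝ) ≤ 7 * ((latticeDist a.1 b.1 / 7 : ℕ) : ℝ) + 7 := by
    exact_mod_cast h1
  linarith

theorem map_eq_infinitePi {Ω : Type*} [MeasurableSpace Ω] {P : Measure Ω}
    {ω : Site × Fin 3 → Ω → ℝ} (hω : ∀ a, Measurable (ω a)) (hindep : iIndepFun ω P)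
    (hunif : ∀ a, pdf.IsUniform (ω a) (Set.Ico 0 (2 * Real.pi)) P volume) :
    P.map (fun w a => ω a w) = Measure.infinitePi fun _ => phaseMeasure := by
  rw [hindep.map_fun_eq_infinitePi_map hω]
  congr 1
  funext a
  exact hunif a

end Constants

end

end HexWalk

/-! ### Dynamical localization -/

theorem mainTheorem2 :
    ∃ φ c g : ℝ, 0 < φ ∧ 0 < c ∧ 0 < g ∧
      ∀ C : Matrix.unitaryGroup (Fin 3) ℂ,
        HexWalk.maxNorm ((C : Matrix (Fin 3) (Fin 3) ℂ) - HexWalk.C₀) ≤ φ →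
      ∀ (Ω : Type*) [MeasurableSpace Ω] (P : Measure Ω) [IsProbabilityMeasure P]
        (ω : HexWalk.Site × Fin 3 → Ω → ℝ),
        (∀ a, Measurable (ω a)) →
        iIndepFun ω P →
        (∀ a, pdf.IsUniform (ω a) (Set.Ico 0 (2 * Real.pi)) P volume) →
      ∀ (x y : HexWalk.Site) (i j : Fin 3),
        ∫⁻ w, ⨆ n : ℤ,
            ‖inner ℂ (HexWalk.ket x i)
              ((HexWalk.walk (fun a => ω a w) C ^ n) (HexWalk.ket y j))‖ₑ ∂P
          ≤ ENNReal.ofReal (c * Real.exp (-g * HexWalk.latticeDist x y)) := by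
  obtain ⟨K, hKtop, hK1, hK⟩ := HexWalk.exists_lintegral_phase_rpow_neg_half_le
  have hKpos : 0 < K.toReal := ENNReal.toReal_pos (zero_lt_one.trans_le hK1).ne' hKtop
  set D : ℝ≥0∞ := 2 * (K * K * ENNReal.ofReal (Real.exp 7)) *
    (6 * (∑' j : ℤ, ENNReal.ofReal (Real.exp (-(|j| : ℤ) / 8))) ^ 2) with hD
  have hDtop : D ≠ ∞ :=
    ENNReal.mul_ne_top (ENNReal.mul_ne_top (by simp) (ENNReal.mul_ne_top
      (ENNReal.mul_ne_top hKtop hKtop) ENNReal.ofReal_ne_top))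
      (ENNReal.mul_ne_top (by simp) (ENNReal.pow_ne_top HexWalk.tsum_int_exp_ne_top))
  -- The rate `1/4` is what the correlator bound keeps between `a` and `b`; adding `1` makes
  -- positivity of `c` immediate.
  refine ⟨(Real.exp (-7) / (48 * K.toReal)) ^ 2, D.toReal + 1, 1 / 4, by positivity,
    by positivity, by norm_num, ?_⟩
  intro C hC Ω _ P _ ω hω hindep hunif x y i j
  have hlaw := HexWalk.map_eq_infinitePi hω hindep hunif
  have h := HexWalk.lintegral_iSup_walk_le hω (x, i) (y, j) fun r hr hr1 =>
    HexWalk.lintegral_correlator_le hω hlaw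
      (fun z hz => HexWalk.fracMoment_le_exp hω hlaw hKtop hK1 hK hC hz) hr hr1 (x, i) (y, j)
  refine h.trans ?_
  rw [mul_left_comm, ← hD, ENNReal.ofReal_mul (by positivity), mul_comm]
  refine mul_le_mul' ?_ (le_of_eq ?_)
  · rw [ENNReal.le_ofReal_iff_toReal_le hDtop (by positivity)]
    linarith
  · congr 2
    ring
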